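/- Let $K$ be an algebraically closed field of characteristic $3$, let $X\subset\mathbb P^3_K$ be a K3 quartic surface, i.e. a surface of degree $4$ whose singularities are at most (isolated) rational double points, with minimal desingularization $\rho:Z\to X$, and let $\ell$ be a line lying on $X$, with strict transform $L\subset Z$. The pencil of planes $\Pi_t$ ($t\in\mathbb P^1$) containing $\ell$ induces a genus $1$ fibration $\pi:Z\to\mathbb P^1$, whose fibers come from the residual cubics $E_t$ defined by $X\cap\Pi_t=\ell+E_t$. The line $\ell$ is called inseparable if $\pi|_L:L\to\mathbb P^1$ is a non-constant inseparable morphism; quasi-elliptic if $\pi$ is quasi-elliptic, i.e. if for all but finitely many $t$ the fiber (equivalently, $E_t$) is an irreducible curve with a cusp; and cuspidal if it is quasi-elliptic and the cuspidal curve of $\pi$ (the closure of the set of cusps of the general fibers) is equal to $L$. The valency $v(\ell)$ is the number of lines on $X$ distinct from $\ell$ which meet $\ell$ in a smooth point of $X$. Then: (1) If $\ell$ is inseparable and $v(\ell)>12$, then $\ell$ is cuspidal. (2) If $\ell$ is cuspidal, then $X$ is projectively equivalent to a surface $$x_0x_3^3-x_1x_2^3+x_2\,q_3(x_0,x_1)+x_3\,q_3'(x_0,x_1)+q_4(x_0,x_1)=0,$$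 where $q_3$, $q_3'$, $q_4$ are (possibly zero) forms over $K$ of degree $3$, $3$ and $4$, respectively. -/

import Mathlib

open scoped LinearAlgebra.Projectivization

namespace QuarticLines

variable {K : Type*} [Field K]

/-- The form `F` written in the linear coordinates `x₀, …, x₃` in which the point with coordinate
vector `x` is the point `A x` of the ambient space, i.e. the form `F(A x)`. -/
noncomputable def coords (A : GL (Fin 4) K) (F : MvPolynomial (Fin 4) K) :
    MvPolynomial (Fin 4) K :=
  MvPolynomial.aeval
    (fun i => ∑ j, MvPolynomial.C ((A : Matrix (Fin 4) (Fin 4) K) i j) * MvPolynomial.X j) F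

/-- The quartic surfaces `F = 0` and `G = 0` in `ℙ³` are projectively equivalent. -/
def ProjectivelyEquivalent (F G : MvPolynomial (Fin 4) K) : Prop :=
  ∃ (A : GL (Fin 4) K) (c : K), c ≠ 0 ∧ coords A F = MvPolynomial.C c * G

/-- The singular points of the surface `F = 0` in `ℙ³`. -/
def singularPoints (F : MvPolynomial (Fin 4) K) : Set (ℙ K (Fin 4 → K)) :=
  {P | MvPolynomial.eval P.rep F = 0 ∧
    ∀ i, MvPolynomial.eval P.rep (MvPolynomial.pderiv i F) = 0}

section RationalDoublePoints

open MvPolynomial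

/-- The equations of the rational double points over an algebraically closed field of
characteristic 3 (Artin's list): `A n` (`n ≥ 1`), `D n` (`n ≥ 4`), `E₆⁰`, `E₆¹`, `E₇⁰`, `E₇¹`,
`E₈⁰`, `E₈¹`, `E₈²`, in the variables `x = X 0`, `y = X 1`, `z = X 2`. -/
inductive IsADENormalForm : MvPolynomial (Fin 3) K → Prop
  | A (n : ℕ) (hn : 1 ≤ n) : IsADENormalForm (X 2 ^ (n + 1) + X 0 * X 1)
  | D (n : ℕ) (hn : 4 ≤ n) : IsADENormalForm (X 2 ^ 2 + X 0 ^ 2 * X 1 + X 1 ^ (n - 1))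
  | E60 : IsADENormalForm (X 2 ^ 2 + X 0 ^ 3 + X 1 ^ 4)
  | E61 : IsADENormalForm (X 2 ^ 2 + X 0 ^ 3 + X 1 ^ 4 + X 0 ^ 2 * X 1 ^ 2)
  | E70 : IsADENormalForm (X 2 ^ 2 + X 0 ^ 3 + X 0 * X 1 ^ 3)
  | E71 : IsADENormalForm (X 2 ^ 2 + X 0 ^ 3 + X 0 * X 1 ^ 3 + X 0 ^ 2 * X 1 ^ 2)
  | E80 : IsADENormalForm (X 2 ^ 2 + X 0 ^ 3 + X 1 ^ 5)
  | E81 : IsADENormalForm (X 2 ^ 2 + X 0 ^ 3 + X 1 ^ 5 + X 0 ^ 2 * X 1 ^ 3)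
  | E82 : IsADENormalForm (X 2 ^ 2 + X 0 ^ 3 + X 1 ^ 5 + X 0 ^ 2 * X 1 ^ 2)

/-- The ring `K⟦x, y, z⟧ / (f)`. For `f(0) = 0` it is the completed local ring at the origin of the
affine surface `f = 0`. -/
abbrev CompletedLocalRing (f : MvPolynomial (Fin 3) K) : Type _ :=
  MvPowerSeries (Fin 3) K ⧸ Ideal.span {(f : MvPowerSeries (Fin 3) K)}

/-- The affine equation of `G = 0` in the chart `x₀ = 1`. -/
noncomputable def affineEquation (G : MvPolynomial (Fin 4) K) : MvPolynomial (Fin 3) K :=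
  aeval ![1, X 0, X 1, X 2] G

/-- `P` is a rational double point of the surface `F = 0` (over an algebraically closed field of
characteristic 3): in linear coordinates with `P = [1 : 0 : 0 : 0]`, the completed local ring at `P`,
computed in the affine chart `x₀ = 1`, is that of one of the normal forms. -/
def IsRationalDoublePoint (F : MvPolynomial (Fin 4) K) (P : ℙ K (Fin 4 → K)) : Prop :=
  ∃ A : GL (Fin 4) K, P.submodule = K ∙ ((A : Matrix (Fin 4) (Fin 4) K).mulVec ![1, 0, 0, 0]) ∧
    ∃ g : MvPolynomial (Fin 3) K, IsADENormalForm g ∧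
      Nonempty (CompletedLocalRing (affineEquation (coords A F)) ≃ₐ[K]
        CompletedLocalRing g)

end RationalDoublePoints

/-- `F = 0` is a K3 quartic surface (over an algebraically closed field of characteristic 3): a
surface of degree 4 in `ℙ³` whose singularities are isolated and are rational double points. -/
structure IsK3Quartic (F : MvPolynomial (Fin 4) K) : Prop where
  isHomogeneous : F.IsHomogeneous 4
  isolated : (singularPoints F).Finite
  rationalDoublePoint : ∀ P ∈ singularPoints F, IsRationalDoublePoint F P

/-- `ℓ` is a line of `ℙ³` (given as a plane in `K⁴`) that lies on the surface `F = 0`. -/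
structure IsLineOn (F : MvPolynomial (Fin 4) K) (ℓ : Submodule K (Fin 4 → K)) : Prop where
  finrank_eq : Module.finrank K ℓ = 2
  eval_eq_zero : ∀ v ∈ ℓ, MvPolynomial.eval v F = 0

/-- The points of the line `ℓ`. -/
def points (ℓ : Submodule K (Fin 4 → K)) : Set (ℙ K (Fin 4 → K)) := {P | P.submodule ≤ ℓ}

/-- The valency of a line `ℓ` on the surface `F = 0`: the number of lines on the surface that are
distinct from `ℓ` and meet `ℓ` in a smooth point of the surface. -/
noncomputable def valency (F : MvPolynomial (Fin 4) K) (ℓ : Submodule K (Fin 4 → K)) : ℕ∞ :=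
  {m : Submodule K (Fin 4 → K) | IsLineOn F m ∧ m ≠ ℓ ∧
    ∃ P ∈ points m ∩ points ℓ, P ∉ singularPoints F}.encard

/-- In the coordinates given by `A`, the line `ℓ` is `x₀ = x₁ = 0`. -/
def IsAdapted (A : GL (Fin 4) K) (ℓ : Submodule K (Fin 4 → K)) : Prop :=
  ℓ = Submodule.span K {(A : Matrix (Fin 4) (Fin 4) K).mulVec ![0, 0, 1, 0],
    (A : Matrix (Fin 4) (Fin 4) K).mulVec ![0, 0, 0, 1]}

section Inseparable

open Polynomial IntermediateField

/-- For `k = 0, 1`: the derivative `∂G/∂x_k` at the point `[0 : 0 : u : 1]` of the line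
`x₀ = x₁ = 0`, as a polynomial in `u`. If the line lies on the surface `G = 0`, these are the
dehomogenized forms `α` (`k = 0`) and `β` (`k = 1`) such that the residual cubic in the plane
`x₀ = t x₁` meets the line in the zeros of `t α + β`. -/
noncomputable def normalDerivative (k : Fin 4) (G : MvPolynomial (Fin 4) K) : K[X] :=
  MvPolynomial.aeval ![0, 0, X, 1] (MvPolynomial.pderiv k G)

/-- The rational function `t = -β/α` of `u` by which the pencil of planes `x₀ = t x₁` gives the
morphism from the line `x₀ = x₁ = 0`, identified with its strict transform, to `ℙ¹`. -/
noncomputable def inducedMap (G : MvPolynomial (Fin 4) K) : RatFunc K :=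
  -(algebraMap K[X] (RatFunc K) (normalDerivative 1 G)) /
    algebraMap K[X] (RatFunc K) (normalDerivative 0 G)

/-- The line `ℓ` is inseparable: the morphism `L → ℙ¹` induced by the pencil of planes through `ℓ`
is not constant, and its extension of function fields `K(u) / K(t)` is not separable. (Whether this
holds does not depend on the choice of the adapted coordinates.) -/
def IsInseparable (F : MvPolynomial (Fin 4) K) (ℓ : Submodule K (Fin 4 → K)) : Prop :=
  ∃ A : GL (Fin 4) K, IsAdapted A ℓ ∧
    inducedMap (coords A F) ∉ Set.range (algebraMap K (RatFunc K)) ∧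
    ¬ Algebra.IsSeparable K⟮inducedMap (coords A F)⟯ (RatFunc K)

end Inseparable

section Cuspidal

open MvPolynomial

/-- The residual cubic `E_t` in the plane `x₀ = t x₁`, in the variables `x₁, x₂, x₃` (numbered
`0, 1, 2`): substitute `t x₁` for `x₀` in `G` and divide by `x₁`. -/
noncomputable def residualCubic (G : MvPolynomial (Fin 4) K) (t : K) : MvPolynomial (Fin 3) K :=
  (aeval ![C t * X 0, X 0, X 1, X 2] G).divMonomial (Finsupp.single 0 1)

/-- The point with coordinates `p` of the plane cubic `g = 0` is a double point with a double
tangent: it is singular and the Hessian matrix, which represents (up to the factor 2) the leading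
form of `g` there, has rank one. On an irreducible cubic in characteristic different from 2 these are
exactly the cusps. -/
def IsCusp (g : MvPolynomial (Fin 3) K) (p : Fin 3 → K) : Prop :=
  p ≠ 0 ∧ eval p g = 0 ∧ (∀ i, eval p (pderiv i g) = 0) ∧
    (Matrix.of fun i j => eval p (pderiv i (pderiv j g))).rank = 1

/-- The general fibres of the fibration induced by the line `x₀ = x₁ = 0` on `G = 0` are irreducible
cubics with a cusp. -/
def HasCuspidalGeneralFiber (G : MvPolynomial (Fin 4) K) : Prop :=
  {t : K | ¬ (Irreducible (residualCubic G t) ∧ ∃ p, IsCusp (residualCubic G t) p)}.Finite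

/-- The line `ℓ` on `F = 0` is quasi-elliptic. (Whether this holds does not depend on the choice of
the adapted coordinates.) -/
def IsQuasiElliptic (F : MvPolynomial (Fin 4) K) (ℓ : Submodule K (Fin 4 → K)) : Prop :=
  ∃ A : GL (Fin 4) K, IsAdapted A ℓ ∧ HasCuspidalGeneralFiber (coords A F)

/-- The points of `ℙ³` that are cusps of a residual cubic `E_t` with `t ∉ S`. -/
def cusps (A : GL (Fin 4) K) (F : MvPolynomial (Fin 4) K) (S : Set K) : Set (ℙ K (Fin 4 → K)) :=
  {P | ∃ t ∉ S, ∃ p, IsCusp (residualCubic (coords A F) t) p ∧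
    P.submodule = K ∙ ((A : Matrix (Fin 4) (Fin 4) K).mulVec ![t * p 0, p 0, p 1, p 2])}

/-- The Zariski closure of a set of points of `ℙ³`. -/
def zariskiClosure (T : Set (ℙ K (Fin 4 → K))) : Set (ℙ K (Fin 4 → K)) :=
  {Q | ∀ (n : ℕ) (H : MvPolynomial (Fin 4) K), H.IsHomogeneous n →
    (∀ P ∈ T, eval P.rep H = 0) → eval Q.rep H = 0}

/-- `D` is the cuspidal curve (in `ℙ³`) of the fibration: the closure of the cusps of the general
fibres, that is, of the cusps of all fibres but finitely many, however many more are left out. -/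
def IsCuspidalCurve (A : GL (Fin 4) K) (F : MvPolynomial (Fin 4) K)
    (D : Set (ℙ K (Fin 4 → K))) : Prop :=
  ∃ S₀ : Set K, S₀.Finite ∧ ∀ S : Set K, S.Finite → S₀ ⊆ S → zariskiClosure (cusps A F S) = D

/-- The line `ℓ` on `F = 0` is cuspidal: it is quasi-elliptic, and the cuspidal curve of its
fibration is the line itself. (Whether this holds does not depend on the choice of the adapted
coordinates.) -/
def IsCuspidal (F : MvPolynomial (Fin 4) K) (ℓ : Submodule K (Fin 4 → K)) : Prop :=
  IsQuasiElliptic F ℓ ∧ ∃ A : GL (Fin 4) K, IsAdapted A ℓ ∧ IsCuspidalCurve A F (points ℓ)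

/-- The member `x₀x₃³ - x₁x₂³ + x₂q₃(x₀,x₁) + x₃q₃'(x₀,x₁) + q₄(x₀,x₁)` of the family. -/
noncomputable def familyC (q₃ q₃' q₄ : MvPolynomial (Fin 2) K) : MvPolynomial (Fin 4) K :=
  X 0 * X 3 ^ 3 - X 1 * X 2 ^ 3 + X 2 * rename ![0, 1] q₃ + X 3 * rename ![0, 1] q₃'
    + rename ![0, 1] q₄

end Cuspidal

end QuarticLines

/-! Put ℓ at x₀ = x₁ = 0 and write the quartic as x₀α + x₁β + Q + L + M, where α, β are cubics in
x₂, x₃ and Q, L, M are the parts of degree 2, 3, 4 in x₀, x₁. The plane x₀ = t x₁ meets ℓ residually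
in tα + β = 0. If the induced map -β/α is inseparable, the Wronskian αβ' - α'β vanishes, and in
characteristic 3 this forces α and β to be linearly independent combinations of x₂³ and x₃³
(`IsPure`).

For (1), a line on the surface through the point s of ℓ has direction (-β(s), α(s), m, 0). The
restriction of the quartic to it is a cubic polynomial whose remaining coefficients say f(s) = 0,
f'(s)m + g(s) = 0 and a cubic equation for m with leading coefficient `det`. Here f is
`tangentPoly`, of degree at most 8, and g is `cuspPoly`. Hence a simple zero of f carries at most
one line, a multiple zero at most three, and the zeros, infinity included, carry at most 3·8/2 = 12
(`encard_lines_le`). More than 12 lines force f = 0, hence Q = 0. If g were also 0, then L = 0 and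
the surface would be singular along a curve (`exists_isSingularVector`), although its singularities
are isolated. With Q = 0 and g ≠ 0, the general residual cubic is r(x₁ - s x₂)³ + x₀²(b₀x₂ + b₁x₁) +
m x₀³ with b₀ + b₁s ≠ 0 in the plane coordinates: an irreducible cubic whose only cusp lies on ℓ,
and these cusps are dense in ℓ (`isCuspidal_of_pure`).

For (2), infinitely many points of ℓ are cusps of residual cubics. Vanishing of the gradient there
kills the Wronskian, which gives purity once degenerate pencils are excluded
(`isPure_of_isCuspidalCurve`), and then kills f, which gives Q = 0. A linear change of x₀, x₁ turns
α, β into x₃³, -x₂³ (`exists_familyC`). -/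

namespace QuarticLines

/-! ### Linear changes of coordinates and singular vectors -/

section Coordinates

open MvPolynomial

variable {K : Type*} [Field K]

theorem eval_coords (A : GL (Fin 4) K) (F : MvPolynomial (Fin 4) K) (v : Fin 4 → K) :
    eval v (coords A F) = eval ((A : Matrix (Fin 4) (Fin 4) K).mulVec v) F := by
  unfold coords
  induction F using MvPolynomial.induction_on with
  | C a => simp
  | add p q hp hq => simp only [map_add, hp, hq]
  | mul_X p i hp =>
    simp only [map_mul, hp, aeval_X, map_sum, eval_C, eval_X, Matrix.mulVec, dotProduct]

theorem coords_mul (A B : GL (Fin 4) K) (F : MvPolynomial (Fin 4) K) :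
    coords (A * B) F = coords B (coords A F) := by
  have h : (fun i => ∑ j, C (((A * B : GL (Fin 4) K) : Matrix (Fin 4) (Fin 4) K) i j) * X j) =
      fun i => aeval (fun i => ∑ j, C ((B : Matrix (Fin 4) (Fin 4) K) i j) * X j)
        (∑ j, C ((A : Matrix (Fin 4) (Fin 4) K) i j) * (X j : MvPolynomial (Fin 4) K)) := by
    funext i
    simp only [aeval_X, map_sum, map_mul, Units.val_mul, Matrix.mul_apply,
      algHom_C, algebraMap_eq, Finset.sum_mul, Finset.mul_sum, mul_assoc]
    rw [Finset.sum_comm]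
  rw [coords, coords, coords, h, comp_aeval_apply]

theorem coords_one (F : MvPolynomial (Fin 4) K) : coords 1 F = F := by
  have h : (fun i => ∑ j, C (((1 : GL (Fin 4) K) : Matrix (Fin 4) (Fin 4) K) i j) * X j) =
      (X : Fin 4 → MvPolynomial (Fin 4) K) := by
    funext i
    rw [Finset.sum_eq_single i] <;> simp +contextual [eq_comm]
  rw [coords, h, aeval_X_left_apply]

theorem isHomogeneous_coords (A : GL (Fin 4) K) {F : MvPolynomial (Fin 4) K} {n : ℕ}
    (hF : F.IsHomogeneous n) : (coords A F).IsHomogeneous n := by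
  have h := hF.aeval (n := 1)
    (fun i => ∑ j, C ((A : Matrix (Fin 4) (Fin 4) K) i j) * X j)
    (fun i => IsHomogeneous.sum _ _ _ fun j _ => (isHomogeneous_X K j).C_mul _)
  simpa [coords] using h

theorem pderiv_aeval {σ τ : Type*} [Fintype σ] (i : τ) (f : σ → MvPolynomial τ K)
    (G : MvPolynomial σ K) :
    pderiv i (aeval f G) = ∑ j, aeval f (pderiv j G) * pderiv i (f j) := by
  classical
  induction G using MvPolynomial.induction_on with
  | C a => simp
  | add p q hp hq => simp only [map_add, hp, hq, add_mul, Finset.sum_add_distrib]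
  | mul_X p k hp =>
    simp only [map_mul, aeval_X, Derivation.leibniz, hp, smul_eq_mul, map_add, pderiv_X,
      add_mul, Finset.sum_add_distrib]
    congr 1
    · rw [Finset.sum_eq_single k]
      · simp
      · intro b _ hb
        simp [hb.symm]
      · simp
    · rw [Finset.mul_sum]
      exact Finset.sum_congr rfl fun _ _ => by ring

theorem eval_smul_of_isHomogeneous {σ : Type*} {G : MvPolynomial σ K} {n : ℕ}
    (hG : G.IsHomogeneous n) (a : K) (v : σ → K) :
    eval (a • v) G = a ^ n * eval v G := by
  rw [eval_eq, eval_eq, Finset.mul_sum]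
  refine Finset.sum_congr rfl fun d hd => ?_
  have hdeg : ∑ i ∈ d.support, d i = n := by
    have := hG.degree_eq_sum_deg_support hd
    simpa [Finsupp.degree] using this.symm
  simp only [Pi.smul_apply, smul_eq_mul, mul_pow, Finset.prod_mul_distrib,
    Finset.prod_pow_eq_pow_sum, hdeg]
  ring

/-- A vector is singular for `F` if `F` and its gradient vanish there. -/
def IsSingularVector (F : MvPolynomial (Fin 4) K) (v : Fin 4 → K) : Prop :=
  eval v F = 0 ∧ ∀ i, eval v (pderiv i F) = 0

theorem IsSingularVector.smul {F : MvPolynomial (Fin 4) K} {n : ℕ} (hF : F.IsHomogeneous n)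
    {v : Fin 4 → K} (hv : IsSingularVector F v) (a : K) : IsSingularVector F (a • v) := by
  refine ⟨?_, fun i => ?_⟩
  · rw [eval_smul_of_isHomogeneous hF, hv.1, mul_zero]
  · rw [eval_smul_of_isHomogeneous (hF.pderiv (i := i)), hv.2 i, mul_zero]

/-- Since F is `coords A⁻¹` of `coords A F`, the chain rule writes each partial derivative of F as a
combination of those of `coords A F`. -/
theorem IsSingularVector.of_coords {A : GL (Fin 4) K} {F : MvPolynomial (Fin 4) K}
    {v : Fin 4 → K} (hv : IsSingularVector (coords A F) v) :
    IsSingularVector F ((A : Matrix (Fin 4) (Fin 4) K).mulVec v) := by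
  have hmul : ((A⁻¹ : GL (Fin 4) K) : Matrix (Fin 4) (Fin 4) K).mulVec
      ((A : Matrix (Fin 4) (Fin 4) K).mulVec v) = v := by
    rw [Matrix.mulVec_mulVec, ← Units.val_mul, inv_mul_cancel, Units.val_one, Matrix.one_mulVec]
  have hF : coords A⁻¹ (coords A F) = F := by
    rw [← coords_mul, mul_inv_cancel, coords_one]
  refine ⟨by rw [← eval_coords]; exact hv.1, fun i => ?_⟩
  rw [← hF]
  conv_lhs => rw [coords, pderiv_aeval]
  rw [map_sum]
  refine Finset.sum_eq_zero fun j _ => ?_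
  have := eval_coords A⁻¹ (pderiv j (coords A F)) ((A : Matrix (Fin 4) (Fin 4) K).mulVec v)
  rw [hmul, hv.2 j] at this
  rw [map_mul]
  erw [this]
  rw [zero_mul]

theorem mulVec_ne_zero (A : GL (Fin 4) K) {v : Fin 4 → K} (hv : v ≠ 0) :
    (A : Matrix (Fin 4) (Fin 4) K).mulVec v ≠ 0 := fun h => hv <| by
  have := congrArg ((A⁻¹ : GL (Fin 4) K) : Matrix (Fin 4) (Fin 4) K).mulVec h
  rwa [Matrix.mulVec_mulVec, ← Units.val_mul, inv_mul_cancel, Units.val_one, Matrix.one_mulVec,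
    Matrix.mulVec_zero] at this

theorem mulVec_injective (A : GL (Fin 4) K) :
    Function.Injective (A : Matrix (Fin 4) (Fin 4) K).mulVec := fun v w h => by
  by_contra hne
  exact mulVec_ne_zero A (sub_ne_zero.mpr hne) (by rw [Matrix.mulVec_sub, h, sub_self])

theorem exists_mulVec_eq (A : GL (Fin 4) K) (w : Fin 4 → K) :
    ∃ v, (A : Matrix (Fin 4) (Fin 4) K).mulVec v = w :=
  ⟨((A⁻¹ : GL (Fin 4) K) : Matrix (Fin 4) (Fin 4) K).mulVec w, by
    rw [Matrix.mulVec_mulVec, ← Units.val_mul, mul_inv_cancel, Units.val_one, Matrix.one_mulVec]⟩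

/-- On a K3 quartic there is no infinite family of pairwise non-proportional singular vectors. -/
theorem IsK3Quartic.false_of_singular_family [Infinite K] {F : MvPolynomial (Fin 4) K}
    (hF : IsK3Quartic F) (A : GL (Fin 4) K) (v : K → Fin 4 → K) (hv : ∀ s, v s ≠ 0)
    (hinj : ∀ (s s' a : K), a • v s = v s' → s = s')
    (hsing : ∀ s, IsSingularVector (coords A F) (v s)) : False := by
  let φ : K → ℙ K (Fin 4 → K) := fun s => .mk K _ (mulVec_ne_zero A (hv s))
  have hφ : Function.Injective φ := by
    intro s s' h
    obtain ⟨a, ha⟩ := (Projectivization.mk_eq_mk_iff' K _ _ _ _).mp h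
    rw [← Matrix.mulVec_smul] at ha
    exact (hinj s' s a (mulVec_injective A ha)).symm
  refine Set.infinite_range_of_injective hφ (hF.isolated.subset ?_)
  rintro _ ⟨s, rfl⟩
  obtain ⟨a, ha⟩ := Projectivization.exists_smul_eq_mk_rep K _ (mulVec_ne_zero A (hv s))
  have := (hsing s).of_coords.smul hF.isHomogeneous a
  change IsSingularVector F (φ s).rep
  rwa [← ha]

end Coordinates

/-- The coefficients of a quartic form containing the line `x₀ = x₁ = 0`, grouped by the degree in
`x₀, x₁`: the cubic forms `α = ∑ a i x₂^i x₃^(3-i)` and `β = ∑ b i x₂^i x₃^(3-i)`, then the parts of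
degree 2, 3 and 4, where the first index is the exponent of `x₁` and the last one that of `x₂`. -/
structure LineCoeffs (K : Type*) where
  a : Fin 4 → K
  b : Fin 4 → K
  Q : Fin 3 → Fin 3 → K
  L : Fin 4 → Fin 2 → K
  M : Fin 5 → K

namespace LineCoeffs

variable {K : Type*} [Field K]

section Quartic

open MvPolynomial

/-- The quartic form with the given coefficients. -/
noncomputable def quartic (c : LineCoeffs K) : MvPolynomial (Fin 4) K :=
  X 0 * (C (c.a 0) * X 3 ^ 3 + C (c.a 1) * X 2 * X 3 ^ 2 + C (c.a 2) * X 2 ^ 2 * X 3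
    + C (c.a 3) * X 2 ^ 3)
  + X 1 * (C (c.b 0) * X 3 ^ 3 + C (c.b 1) * X 2 * X 3 ^ 2 + C (c.b 2) * X 2 ^ 2 * X 3
    + C (c.b 3) * X 2 ^ 3)
  + X 0 ^ 2 * (C (c.Q 0 0) * X 3 ^ 2 + C (c.Q 0 1) * X 2 * X 3 + C (c.Q 0 2) * X 2 ^ 2)
  + X 0 * X 1 * (C (c.Q 1 0) * X 3 ^ 2 + C (c.Q 1 1) * X 2 * X 3 + C (c.Q 1 2) * X 2 ^ 2)
  + X 1 ^ 2 * (C (c.Q 2 0) * X 3 ^ 2 + C (c.Q 2 1) * X 2 * X 3 + C (c.Q 2 2) * X 2 ^ 2)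
  + X 0 ^ 3 * (C (c.L 0 0) * X 3 + C (c.L 0 1) * X 2)
  + X 0 ^ 2 * X 1 * (C (c.L 1 0) * X 3 + C (c.L 1 1) * X 2)
  + X 0 * X 1 ^ 2 * (C (c.L 2 0) * X 3 + C (c.L 2 1) * X 2)
  + X 1 ^ 3 * (C (c.L 3 0) * X 3 + C (c.L 3 1) * X 2)
  + (C (c.M 0) * X 0 ^ 4 + C (c.M 1) * X 0 ^ 3 * X 1 + C (c.M 2) * X 0 ^ 2 * X 1 ^ 2
    + C (c.M 3) * X 0 * X 1 ^ 3 + C (c.M 4) * X 1 ^ 4)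

end Quartic

end LineCoeffs

/-! ### Normal form of a quartic containing the line x₀ = x₁ = 0 -/

section Expansion

open MvPolynomial

variable {K : Type*} [Field K]

theorem eq_sum_antidiagonalTuple {G : MvPolynomial (Fin 4) K} {n : ℕ} (hG : G.IsHomogeneous n) :
    ∃ g : (Fin 4 → ℕ) → K, G = ∑ d ∈ Finset.Nat.antidiagonalTuple 4 n,
      C (g d) * (X 0 ^ d 0 * X 1 ^ d 1 * X 2 ^ d 2 * X 3 ^ d 3) := by
  refine ⟨fun d => coeff (Finsupp.equivFunOnFinite.symm d) G, ?_⟩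
  conv_lhs => rw [G.as_sum]
  refine Finset.sum_bij_ne_zero (fun d _ _ => Finsupp.equivFunOnFinite d) ?_ ?_ ?_ ?_
  · intro d hd _
    rw [Finset.Nat.mem_antidiagonalTuple]
    have := hG.degree_eq_sum_deg_support hd
    rw [this]
    exact (Finsupp.sum_fintype d (fun _ m => m) (by simp)).symm
  · intro d _ _ e _ _ h
    exact Finsupp.equivFunOnFinite.injective h
  · intro d _ hd
    refine ⟨Finsupp.equivFunOnFinite.symm d, ?_, ?_, by simp⟩
    · rw [mem_support_iff]
      rintro h
      simp [h] at hd
    · rw [Ne, monomial_eq_zero]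
      rintro h
      simp [h] at hd
  · intro d _ _
    rw [monomial_eq, Finsupp.prod_fintype _ _ (by simp), Fin.prod_univ_four]
    simp

/-- Nested ranges make the sum over the 35 quartic monomials expand by `simp`. -/
theorem sum_antidiagonalTuple_four_four {M : Type*} [AddCommMonoid M] (f : (Fin 4 → ℕ) → M) :
    ∑ d ∈ Finset.Nat.antidiagonalTuple 4 4, f d =
      ∑ i ∈ Finset.range 5, ∑ j ∈ Finset.range (5 - i), ∑ k ∈ Finset.range (5 - i - j),
        f ![i, j, k, 4 - i - j - k] := by
  simp only [Finset.sum_sigma']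
  refine Finset.sum_bij' (fun d _ => ⟨d 0, d 1, d 2⟩)
    (fun x _ => ![x.1, x.2.1, x.2.2, 4 - x.1 - x.2.1 - x.2.2]) ?_ ?_ ?_ ?_ ?_
  · intro d hd
    rw [Finset.Nat.mem_antidiagonalTuple, Fin.sum_univ_four] at hd
    simp only [Finset.mem_sigma, Finset.mem_range]
    omega
  · rintro ⟨i, j, k⟩ h
    simp only [Finset.mem_sigma, Finset.mem_range] at h
    rw [Finset.Nat.mem_antidiagonalTuple, Fin.sum_univ_four]
    simp
    omega
  · intro d hd
    rw [Finset.Nat.mem_antidiagonalTuple, Fin.sum_univ_four] at hd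
    funext i
    fin_cases i <;> simp
    omega
  · rintro ⟨i, j, k⟩ _
    rfl
  · intro d hd
    rw [Finset.Nat.mem_antidiagonalTuple, Fin.sum_univ_four] at hd
    congr 1
    funext i
    fin_cases i <;> simp
    omega

theorem exists_lineCoeffs [Infinite K] {G : MvPolynomial (Fin 4) K} (hG : G.IsHomogeneous 4)
    (hline : ∀ u, eval ![0, 0, u, 1] G = 0) : ∃ c : LineCoeffs K, G = c.quartic := by
  obtain ⟨g, hg⟩ := eq_sum_antidiagonalTuple hG
  rw [sum_antidiagonalTuple_four_four] at hg
  simp [Finset.sum_range_succ] at hg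
  -- The restriction to the line involves only the five monomials in x₂, x₃, so these are the
  -- coefficients that vanish.
  have hz : (Polynomial.C (g ![0, 0, 0, 4]) + Polynomial.C (g ![0, 0, 1, 3]) * Polynomial.X
      + Polynomial.C (g ![0, 0, 2, 2]) * Polynomial.X ^ 2
      + Polynomial.C (g ![0, 0, 3, 1]) * Polynomial.X ^ 3
      + Polynomial.C (g ![0, 0, 4, 0]) * Polynomial.X ^ 4 : Polynomial K) = 0 := by
    refine Polynomial.funext fun u => ?_
    have := hline u
    rw [hg] at this
    simp at this
    simpa using this
  have h0 := congrArg (Polynomial.coeff · 0) hz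
  have h1 := congrArg (Polynomial.coeff · 1) hz
  have h2 := congrArg (Polynomial.coeff · 2) hz
  have h3 := congrArg (Polynomial.coeff · 3) hz
  have h4 := congrArg (Polynomial.coeff · 4) hz
  simp [Polynomial.coeff_X, Polynomial.coeff_C] at h0 h1 h2 h3 h4
  refine ⟨⟨fun i => g ![1, 0, i, 3 - i], fun i => g ![0, 1, i, 3 - i],
    fun i j => g ![2 - i, i, j, 2 - j], fun i j => g ![3 - i, i, j, 1 - j],
    fun i => g ![4 - i, i, 0, 0]⟩, ?_⟩
  rw [hg, LineCoeffs.quartic]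
  simp [h0, h1, h2, h3, h4]
  ring

end Expansion

namespace LineCoeffs

variable {K : Type*} [Field K]

/-! ### Pencils of binary cubics with zero Wronskian -/

section Pencil

open Polynomial

/-- The dehomogenized form `α`. -/
noncomputable def alpha (c : LineCoeffs K) : K[X] :=
  C (c.a 0) + C (c.a 1) * X + C (c.a 2) * X ^ 2 + C (c.a 3) * X ^ 3

/-- The dehomogenized form `β`. -/
noncomputable def beta (c : LineCoeffs K) : K[X] :=
  C (c.b 0) + C (c.b 1) * X + C (c.b 2) * X ^ 2 + C (c.b 3) * X ^ 3

theorem normalDerivative_zero (c : LineCoeffs K) : normalDerivative 0 c.quartic = c.alpha := by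
  simp [normalDerivative, quartic, alpha, MvPolynomial.pderiv_X, algebraMap_eq]

theorem normalDerivative_one (c : LineCoeffs K) : normalDerivative 1 c.quartic = c.beta := by
  simp [normalDerivative, quartic, beta, MvPolynomial.pderiv_X, algebraMap_eq]

theorem alpha_eq_zero {c : LineCoeffs K} (h : c.alpha = 0) : c.a = 0 := by
  have h0 := congrArg (coeff · 0) h
  have h1 := congrArg (coeff · 1) h
  have h2 := congrArg (coeff · 2) h
  have h3 := congrArg (coeff · 3) h
  simp [alpha, coeff_X, coeff_C] at h0 h1 h2 h3
  funext i
  fin_cases i <;> assumption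

/-- The determinant of the pencil spanned by `α = a₀ x₃³ + a₃ x₂³` and `β = b₀ x₃³ + b₃ x₂³`. -/
def det (c : LineCoeffs K) : K := c.a 0 * c.b 3 - c.a 3 * c.b 0

/-- In characteristic 3: the forms `α` and `β` are linearly independent cubes. -/
structure IsPure (c : LineCoeffs K) : Prop where
  a1 : c.a 1 = 0
  a2 : c.a 2 = 0
  b1 : c.b 1 = 0
  b2 : c.b 2 = 0
  det_ne_zero : c.det ≠ 0

/-- A pencil of binary cubics in characteristic 3 with zero Wronskian is either degenerate or
consists of cubes. -/
theorem isPure_or_proportional [CharP K 3] (c : LineCoeffs K)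
    (hW : c.alpha * derivative c.beta - derivative c.alpha * c.beta = 0) :
    c.IsPure ∨ ∃ (w : Fin 4 → K) (l m : K), c.a = l • w ∧ c.b = m • w := by
  have three : (3 : K) = 0 := CharP.cast_eq_zero K 3
  -- The Wronskian contains all six 2 × 2 minors of (a, b), but the minor (0, 3), which is `det`,
  -- occurs only with the factor 3. So the other five vanish: if `det` does too, a and b are
  -- proportional; otherwise the middle coefficients must be zero.
  have hexp : C (c.a 0 * c.b 1 - c.a 1 * c.b 0) + C (2 * (c.a 0 * c.b 2 - c.a 2 * c.b 0)) * X
      + C (c.a 1 * c.b 2 - c.a 2 * c.b 1 + 3 * (c.a 0 * c.b 3 - c.a 3 * c.b 0)) * X ^ 2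
      + C (c.a 3 * c.b 1 - c.a 1 * c.b 3 + 3 * (c.a 1 * c.b 3 - c.a 3 * c.b 1)) * X ^ 3
      + C (c.a 2 * c.b 3 - c.a 3 * c.b 2) * X ^ 4 = (0 : K[X]) := by
    rw [← hW]
    simp [alpha, beta, C_ofNat]
    ring
  have h0 := congrArg (coeff · 0) hexp
  have h1 := congrArg (coeff · 1) hexp
  have h2 := congrArg (coeff · 2) hexp
  have h3 := congrArg (coeff · 3) hexp
  have h4 := congrArg (coeff · 4) hexp
  simp [-map_sub, -map_add, -map_mul, coeff_X, coeff_C] at h0 h1 h2 h3 h4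
  rw [three, zero_mul, add_zero] at h2 h3
  have two : (2 : K) ≠ 0 := fun h => one_ne_zero (α := K) (by linear_combination three - h)
  replace h1 : c.a 0 * c.b 2 - c.a 2 * c.b 0 = 0 := h1.resolve_left two
  by_cases hdet : c.det = 0
  · right
    rw [det] at hdet
    by_cases ha : c.a = 0
    · exact ⟨c.b, 0, 1, by simp [ha], by simp⟩
    · obtain ⟨i, hi⟩ := Function.ne_iff.mp ha
      refine ⟨c.a, 1, c.b i / c.a i, by simp, ?_⟩
      funext j
      simp only [Pi.zero_apply, Pi.smul_apply, smul_eq_mul] at hi ⊢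
      rw [div_mul_eq_mul_div, eq_div_iff hi]
      fin_cases i <;> fin_cases j <;> simp at hi ⊢ <;> first
        | linear_combination h0
        | linear_combination -h0
        | linear_combination h1
        | linear_combination -h1
        | linear_combination h2
        | linear_combination -h2
        | linear_combination h3
        | linear_combination -h3
        | linear_combination h4
        | linear_combination -h4
        | linear_combination hdet
        | linear_combination -hdet
  · left
    rw [det] at hdet
    constructor
    · refine (mul_eq_zero.mp ?_).resolve_right hdet
      linear_combination -c.a 0 * h3 + c.a 3 * h0
    · refine (mul_eq_zero.mp ?_).resolve_right hdet
      linear_combination c.a 0 * h4 + c.a 3 * h1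
    · refine (mul_eq_zero.mp ?_).resolve_right hdet
      linear_combination -c.b 0 * h3 + c.b 3 * h0
    · refine (mul_eq_zero.mp ?_).resolve_right hdet
      linear_combination c.b 0 * h4 + c.b 3 * h1
    · exact hdet

end Pencil

end LineCoeffs

/-! ### Separability from a nonzero Wronskian -/

section Separability

open Polynomial IntermediateField

variable {K : Type*} [Field K]

/-- If `β / α` is not constant and `α β' - α' β ≠ 0`, then `K(u)` is separable over `K(β / α)`. -/
theorem isSeparable_adjoin_div {α β : K[X]} (hα : α ≠ 0)
    (hW : α * derivative β - derivative α * β ≠ 0) :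
    Algebra.IsSeparable
      K⟮-(algebraMap K[X] (RatFunc K) β) / algebraMap K[X] (RatFunc K) α⟯ (RatFunc K) := by
  set t : RatFunc K := -(algebraMap K[X] (RatFunc K) β) / algebraMap K[X] (RatFunc K) α with ht
  have hα' : algebraMap K[X] (RatFunc K) α ≠ 0 := by simpa using hα
  have hta : t * algebraMap K[X] (RatFunc K) α = -(algebraMap K[X] (RatFunc K) β) :=
    div_mul_cancel₀ _ hα'
  -- P = tα + β has the generator u as a root, and α(u)P'(u) is the Wronskian because tα(u) = -β(u).
  let P : K⟮t⟯[X] := C (AdjoinSimple.gen K t) * α.map (algebraMap K K⟮t⟯) +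
    β.map (algebraMap K K⟮t⟯)
  have haeval (q : K[X]) : aeval (RatFunc.X : RatFunc K) (q.map (algebraMap K K⟮t⟯)) =
      algebraMap K[X] (RatFunc K) q := by
    rw [aeval_map_algebraMap, RatFunc.aeval_X_left_eq_algebraMap]
  have hP : aeval (RatFunc.X : RatFunc K) P = 0 := by
    simp only [P, map_add, map_mul, haeval, aeval_C, AdjoinSimple.algebraMap_gen]
    rw [hta, neg_add_cancel]
  have hP' : aeval (RatFunc.X : RatFunc K) (derivative P) ≠ 0 := by
    simp only [P, derivative_mul, derivative_C, zero_mul, zero_add,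
      derivative_map, map_add, map_mul, haeval, aeval_C, AdjoinSimple.algebraMap_gen]
    intro h
    refine hW ((FaithfulSMul.algebraMap_injective K[X] (RatFunc K)) ?_)
    simp only [map_sub, map_mul, map_zero]
    linear_combination algebraMap K[X] (RatFunc K) α * h
      - algebraMap K[X] (RatFunc K) (derivative α) * hta
  have hP0 : P ≠ 0 := by
    rintro h
    simp [h] at hP'
  have hint : IsIntegral K⟮t⟯ (RatFunc.X : RatFunc K) :=
    isAlgebraic_iff_isIntegral.mp ⟨P, hP0, hP⟩
  have hsep : _root_.IsSeparable K⟮t⟯ (RatFunc.X : RatFunc K) := by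
    rw [_root_.IsSeparable, separable_iff_derivative_ne_zero (minpoly.irreducible hint)]
    intro h
    -- If the minimal polynomial μ had zero derivative, then P = μq would give P'(u) = μ(u)q'(u) =
    -- 0.
    obtain ⟨q, hq⟩ := minpoly.dvd K⟮t⟯ (RatFunc.X : RatFunc K) hP
    apply hP'
    rw [hq, derivative_mul, h]
    simp
  have htop : K⟮t⟯⟮(RatFunc.X : RatFunc K)⟯ = ⊤ := RatFunc.IntermediateField.adjoin_X _
  have := (isSeparable_adjoin_simple_iff_isSeparable K⟮t⟯ (RatFunc K)).mpr hsep
  rw [htop] at this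
  exact Algebra.IsSeparable.of_algHom K⟮t⟯ _ (topEquiv.symm : RatFunc K ≃ₐ[K⟮t⟯] _).toAlgHom

end Separability

namespace LineCoeffs

variable {K : Type*} [Field K]

open Polynomial IntermediateField

theorem isPure_of_inseparable [CharP K 3] {c : LineCoeffs K}
    (hconst : inducedMap c.quartic ∉ Set.range (algebraMap K (RatFunc K)))
    (hins : ¬ Algebra.IsSeparable K⟮inducedMap c.quartic⟯ (RatFunc K)) : c.IsPure := by
  rw [inducedMap, normalDerivative_zero, normalDerivative_one] at hconst hins
  have hα : c.alpha ≠ 0 := by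
    rintro h
    exact hconst ⟨0, by simp [h]⟩
  have hW : c.alpha * derivative c.beta - derivative c.alpha * c.beta = 0 := by
    by_contra h
    exact hins (isSeparable_adjoin_div hα h)
  refine (isPure_or_proportional c hW).resolve_right ?_
  rintro ⟨w, l, m, ha, hb⟩
  have hl : l ≠ 0 := by
    rintro rfl
    exact hα (by simp [alpha, ha])
  refine hconst ⟨-(m / l), ?_⟩
  have hβ : c.beta = C (m / l) * c.alpha := by
    simp only [alpha, beta, ha, hb, Pi.smul_apply, smul_eq_mul]
    have (x : K) : C (m * x) = C (m / l) * C (l * x) := by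
      rw [← C_mul]
      congr 1
      field_simp
    simp only [this]
    ring
  have hα' : algebraMap K[X] (RatFunc K) c.alpha ≠ 0 := by simpa using hα
  rw [hβ, map_mul, eq_div_iff hα', map_neg, neg_mul]
  rfl

end LineCoeffs

namespace LineCoeffs

variable {K : Type*} [Field K]

/-! ### The polynomials controlling contact along the line -/

section Contact

open Polynomial

/-- The coefficient of `u^(3k+j)` in the polynomial `β² Q₀ - α β Q₁ + α² Q₂`. -/
def tangentCoeff (c : LineCoeffs K) : Fin 3 → Fin 3 → K := fun k j =>
  ![c.b 0 ^ 2 * c.Q 0 j - c.a 0 * c.b 0 * c.Q 1 j + c.a 0 ^ 2 * c.Q 2 j,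
    2 * c.b 0 * c.b 3 * c.Q 0 j - (c.a 0 * c.b 3 + c.a 3 * c.b 0) * c.Q 1 j
      + 2 * c.a 0 * c.a 3 * c.Q 2 j,
    c.b 3 ^ 2 * c.Q 0 j - c.a 3 * c.b 3 * c.Q 1 j + c.a 3 ^ 2 * c.Q 2 j] k

/-- For pure coefficients: the polynomial `β² Q₀ - α β Q₁ + α² Q₂`, whose zeros are the points of
the line where the residual cubic through them is singular. -/
noncomputable def tangentPoly (c : LineCoeffs K) : K[X] :=
  ∑ k : Fin 3, ∑ j : Fin 3, C (c.tangentCoeff k j) * X ^ (3 * (k : ℕ) + j)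

/-- The value of the pure form `α`. -/
def pureA (c : LineCoeffs K) (s : K) : K := c.a 0 + c.a 3 * s ^ 3

/-- The value of the pure form `β`. -/
def pureB (c : LineCoeffs K) (s : K) : K := c.b 0 + c.b 3 * s ^ 3

theorem eval_tangentPoly (c : LineCoeffs K) (s : K) : c.tangentPoly.eval s =
    c.pureB s ^ 2 * (c.Q 0 0 + c.Q 0 1 * s + c.Q 0 2 * s ^ 2)
      - c.pureA s * c.pureB s * (c.Q 1 0 + c.Q 1 1 * s + c.Q 1 2 * s ^ 2)
      + c.pureA s ^ 2 * (c.Q 2 0 + c.Q 2 1 * s + c.Q 2 2 * s ^ 2) := by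
  simp [tangentPoly, tangentCoeff, Fin.sum_univ_three, pureA, pureB]
  ring

/-- In characteristic 3 the cubes `pureA` and `pureB` behave as constants, so only the factors Qᵢ
are differentiated. This identifies f' with the coefficient of m in the linear term on a line. -/
theorem eval_derivative_tangentPoly [CharP K 3] (c : LineCoeffs K) (s : K) :
    c.tangentPoly.derivative.eval s =
      c.pureB s ^ 2 * (c.Q 0 1 + 2 * c.Q 0 2 * s)
        - c.pureA s * c.pureB s * (c.Q 1 1 + 2 * c.Q 1 2 * s)
        + c.pureA s ^ 2 * (c.Q 2 1 + 2 * c.Q 2 2 * s) := by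
  have three : (3 : K) = 0 := CharP.cast_eq_zero K 3
  have h : c.tangentPoly.derivative.eval s =
      c.tangentCoeff 0 1 + 2 * c.tangentCoeff 0 2 * s + c.tangentCoeff 1 1 * s ^ 3
        + 2 * c.tangentCoeff 1 2 * s ^ 4 + c.tangentCoeff 2 1 * s ^ 6
        + 2 * c.tangentCoeff 2 2 * s ^ 7 := by
    simp [tangentPoly, Fin.sum_univ_three]
    linear_combination (c.tangentCoeff 1 0 * s ^ 2 + c.tangentCoeff 1 1 * s ^ 3
      + c.tangentCoeff 1 2 * s ^ 4 + 2 * c.tangentCoeff 2 0 * s ^ 5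
      + 2 * c.tangentCoeff 2 1 * s ^ 6 + 2 * c.tangentCoeff 2 2 * s ^ 7) * three
  rw [h]
  simp [tangentCoeff, pureA, pureB]
  ring

theorem coeff_tangentPoly (c : LineCoeffs K) (k j : Fin 3) :
    c.tangentPoly.coeff (3 * (k : ℕ) + j) = c.tangentCoeff k j := by
  fin_cases k <;> fin_cases j <;> simp [tangentPoly, Fin.sum_univ_three, coeff_X, coeff_C]

theorem natDegree_tangentPoly_le (c : LineCoeffs K) : c.tangentPoly.natDegree ≤ 8 := by
  refine natDegree_sum_le_of_forall_le _ _ fun k _ => natDegree_sum_le_of_forall_le _ _ fun j _ =>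
    (natDegree_C_mul_X_pow_le _ _).trans ?_
  omega

/-- The pure forms involve only u³ and each Qᵢ has degree at most 2, so the powers u^(3k+j) separate
the index j. For fixed j the coefficients are those of a quadratic form after the substitution (-β,
α), which is invertible up to powers of `det`; the combinations below invert it. -/
theorem Q_eq_zero {c : LineCoeffs K} (hdet : c.det ≠ 0) (h : c.tangentPoly = 0) : c.Q = 0 := by
  have hc (k j : Fin 3) : c.tangentCoeff k j = 0 := by rw [← coeff_tangentPoly, h, coeff_zero]
  funext i j
  have h0 := hc 0 j
  have h1 := hc 1 j
  have h2 := hc 2 j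
  simp only [tangentCoeff, Matrix.cons_val] at h0 h1 h2
  refine (mul_eq_zero.mp (?_ : c.det ^ 2 * c.Q i j = 0)).resolve_left (pow_ne_zero 2 hdet)
  rw [det]
  fin_cases i <;> dsimp
  · linear_combination c.a 3 ^ 2 * h0 - c.a 0 * c.a 3 * h1 + c.a 0 ^ 2 * h2
  · linear_combination 2 * c.a 3 * c.b 3 * h0 - (c.a 0 * c.b 3 + c.a 3 * c.b 0) * h1
      + 2 * c.a 0 * c.b 0 * h2
  · linear_combination c.b 3 ^ 2 * h0 - c.b 0 * c.b 3 * h1 + c.b 0 ^ 2 * h2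

/-- The coefficient of `u^(3k+j)` in the polynomial `-β³ L₀ + β² α L₁ - β α² L₂ + α³ L₃`. -/
def cuspCoeff (c : LineCoeffs K) : Fin 4 → Fin 2 → K := fun k j =>
  ![-c.b 0 ^ 3 * c.L 0 j + c.b 0 ^ 2 * c.a 0 * c.L 1 j - c.b 0 * c.a 0 ^ 2 * c.L 2 j
      + c.a 0 ^ 3 * c.L 3 j,
    -3 * c.b 0 ^ 2 * c.b 3 * c.L 0 j + (2 * c.b 0 * c.b 3 * c.a 0 + c.b 0 ^ 2 * c.a 3) * c.L 1 j
      - (c.b 3 * c.a 0 ^ 2 + 2 * c.b 0 * c.a 0 * c.a 3) * c.L 2 j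
      + 3 * c.a 0 ^ 2 * c.a 3 * c.L 3 j,
    -3 * c.b 0 * c.b 3 ^ 2 * c.L 0 j + (c.b 3 ^ 2 * c.a 0 + 2 * c.b 0 * c.b 3 * c.a 3) * c.L 1 j
      - (2 * c.b 3 * c.a 0 * c.a 3 + c.b 0 * c.a 3 ^ 2) * c.L 2 j
      + 3 * c.a 0 * c.a 3 ^ 2 * c.L 3 j,
    -c.b 3 ^ 3 * c.L 0 j + c.b 3 ^ 2 * c.a 3 * c.L 1 j - c.b 3 * c.a 3 ^ 2 * c.L 2 j
      + c.a 3 ^ 3 * c.L 3 j] k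

/-- For pure coefficients: the polynomial `-β³ L₀ + β² α L₁ - β α² L₂ + α³ L₃`. -/
noncomputable def cuspPoly (c : LineCoeffs K) : K[X] :=
  ∑ k : Fin 4, ∑ j : Fin 2, C (c.cuspCoeff k j) * X ^ (3 * (k : ℕ) + j)

theorem eval_cuspPoly (c : LineCoeffs K) (s : K) : c.cuspPoly.eval s =
    -c.pureB s ^ 3 * (c.L 0 0 + c.L 0 1 * s) + c.pureB s ^ 2 * c.pureA s * (c.L 1 0 + c.L 1 1 * s)
      - c.pureB s * c.pureA s ^ 2 * (c.L 2 0 + c.L 2 1 * s)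
      + c.pureA s ^ 3 * (c.L 3 0 + c.L 3 1 * s) := by
  simp [cuspPoly, cuspCoeff, Fin.sum_univ_four, pureA, pureB]
  ring

/-- The same inversion for cubic forms: the Lᵢ have degree at most 1 in u, so residues of exponents
mod 3 again do not mix. -/
theorem L_eq_zero {c : LineCoeffs K} (hdet : c.det ≠ 0) (h : c.cuspPoly = 0) : c.L = 0 := by
  have hc (k : Fin 4) (j : Fin 2) : c.cuspCoeff k j = 0 := by
    have : c.cuspPoly.coeff (3 * (k : ℕ) + j) = c.cuspCoeff k j := by
      fin_cases k <;> fin_cases j <;> simp [cuspPoly, Fin.sum_univ_four, coeff_X, coeff_C]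
    rw [← this, h, coeff_zero]
  funext i j
  have h0 := hc 0 j
  have h1 := hc 1 j
  have h2 := hc 2 j
  have h3 := hc 3 j
  simp only [cuspCoeff, Matrix.cons_val] at h0 h1 h2 h3
  refine (mul_eq_zero.mp (?_ : c.det ^ 3 * c.L i j = 0)).resolve_left (pow_ne_zero 3 hdet)
  rw [det]
  fin_cases i <;> dsimp
  · linear_combination c.a 3 ^ 3 * h0 - c.a 0 * c.a 3 ^ 2 * h1 + c.a 0 ^ 2 * c.a 3 * h2
      - c.a 0 ^ 3 * h3
  · linear_combination c.b 3 * (3 * c.a 3 ^ 2 * h0 - 2 * c.a 0 * c.a 3 * h1 + c.a 0 ^ 2 * h2)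
      - c.b 0 * (c.a 3 ^ 2 * h1 - 2 * c.a 0 * c.a 3 * h2 + 3 * c.a 0 ^ 2 * h3)
  · linear_combination c.a 3 * (3 * c.b 3 ^ 2 * h0 - 2 * c.b 0 * c.b 3 * h1 + c.b 0 ^ 2 * h2)
      - c.a 0 * (c.b 3 ^ 2 * h1 - 2 * c.b 0 * c.b 3 * h2 + 3 * c.b 0 ^ 2 * h3)
  · linear_combination c.b 3 ^ 3 * h0 - c.b 0 * c.b 3 ^ 2 * h1 + c.b 0 ^ 2 * c.b 3 * h2
      - c.b 0 ^ 3 * h3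

end Contact

end LineCoeffs

/-! ### Vanishing cubics, spans of pairs, and weighted counts of zeros -/

section Preliminaries

variable {K : Type*} [Field K]

theorem cubic_coeffs_eq_zero [Infinite K] {c₀ c₁ c₂ c₃ : K}
    (h : ∀ z : K, c₃ * z ^ 3 + c₂ * z ^ 2 + c₁ * z + c₀ = 0) :
    c₃ = 0 ∧ c₂ = 0 ∧ c₁ = 0 ∧ c₀ = 0 := by
  open Polynomial in
  have hp : C c₃ * X ^ 3 + C c₂ * X ^ 2 + C c₁ * X + C c₀ = (0 : K[X]) :=
    Polynomial.funext fun z => by simpa using h z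
  have h0 := congrArg (Polynomial.coeff · 0) hp
  have h1 := congrArg (Polynomial.coeff · 1) hp
  have h2 := congrArg (Polynomial.coeff · 2) hp
  have h3 := congrArg (Polynomial.coeff · 3) hp
  simp [Polynomial.coeff_X, Polynomial.coeff_C] at h0 h1 h2 h3
  exact ⟨h3, h2, h1, h0⟩

theorem eq_span_pair {V : Type*} [AddCommGroup V] [Module K V] {m : Submodule K V}
    (hm : Module.finrank K m = 2) {p w : V} (hp : p ∈ m) (hw : w ∈ m)
    (hli : LinearIndependent K ![p, w]) : m = Submodule.span K {p, w} := by
  have : FiniteDimensional K m := Module.finite_of_finrank_eq_succ hm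
  refine (Submodule.eq_of_le_of_finrank_eq ?_ ?_).symm
  · rw [Submodule.span_le]
    rintro x (rfl | rfl) <;> assumption
  · have := finrank_span_eq_card hli
    rw [Matrix.range_cons, Matrix.range_cons, Matrix.range_empty, Set.union_empty,
      Set.singleton_union] at this
    rw [this, hm, Fintype.card_fin]

/-- The zeros of `f` weighted by numbers that are at most 3, and at most 1 at simple zeros. -/
theorem two_mul_sum_card_le [DecidableEq K] (f : Polynomial K) (hf : f ≠ 0) (N : K → Finset K)
    (h3 : ∀ s, (N s).card ≤ 3) (h1 : ∀ s, f.derivative.eval s ≠ 0 → (N s).card ≤ 1) :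
    2 * ∑ s ∈ f.roots.toFinset, (N s).card ≤ 3 * f.natDegree := by
  have hle : ∑ s ∈ f.roots.toFinset, f.roots.count s ≤ f.natDegree := by
    rw [Multiset.toFinset_sum_count_eq]
    exact f.card_roots'
  refine le_trans ?_ (Nat.mul_le_mul_left 3 hle)
  rw [Finset.mul_sum, Finset.mul_sum]
  refine Finset.sum_le_sum fun s hs => ?_
  have hpos : 0 < f.roots.count s := by
    rwa [Multiset.count_pos, ← Multiset.mem_toFinset]
  rw [Multiset.mem_toFinset, Polynomial.mem_roots hf] at hs
  -- A zero of multiplicity e and weight n satisfies 2n ≤ 3e: either e ≥ 2 and n ≤ 3, or n ≤ 1.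
  by_cases hd : f.derivative.eval s = 0
  · have : 1 < f.rootMultiplicity s :=
      (Polynomial.one_lt_rootMultiplicity_iff_isRoot hf).mpr ⟨hs, hd⟩
    rw [Polynomial.count_roots]
    have := h3 s
    omega
  · have := h1 s hd
    omega

end Preliminaries

namespace LineCoeffs

variable {K : Type*} [Field K]

/-! ### Lines on the quartic that meet the given line -/

section Lines

open MvPolynomial

/-- The restriction of the quartic to the span of `(0, 0, s, 1)` and `(x, y, m, 0)`. -/
theorem eval_quartic_affine [CharP K 3] {c : LineCoeffs K} (hc : c.IsPure) (x y s m z : K) :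
    eval ![x, y, s * z + m, z] c.quartic =
      (x * c.pureA s + y * c.pureB s) * z ^ 3
      + (x ^ 2 * (c.Q 0 0 + c.Q 0 1 * s + c.Q 0 2 * s ^ 2)
        + x * y * (c.Q 1 0 + c.Q 1 1 * s + c.Q 1 2 * s ^ 2)
        + y ^ 2 * (c.Q 2 0 + c.Q 2 1 * s + c.Q 2 2 * s ^ 2)) * z ^ 2
      + ((x ^ 2 * (c.Q 0 1 + 2 * c.Q 0 2 * s) + x * y * (c.Q 1 1 + 2 * c.Q 1 2 * s)
          + y ^ 2 * (c.Q 2 1 + 2 * c.Q 2 2 * s)) * m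
        + (x ^ 3 * (c.L 0 0 + c.L 0 1 * s) + x ^ 2 * y * (c.L 1 0 + c.L 1 1 * s)
          + x * y ^ 2 * (c.L 2 0 + c.L 2 1 * s) + y ^ 3 * (c.L 3 0 + c.L 3 1 * s))) * z
      + ((x * c.a 3 + y * c.b 3) * m ^ 3
        + (x ^ 2 * c.Q 0 2 + x * y * c.Q 1 2 + y ^ 2 * c.Q 2 2) * m ^ 2
        + (x ^ 3 * c.L 0 1 + x ^ 2 * y * c.L 1 1 + x * y ^ 2 * c.L 2 1 + y ^ 3 * c.L 3 1) * m
        + (c.M 0 * x ^ 4 + c.M 1 * x ^ 3 * y + c.M 2 * x ^ 2 * y ^ 2 + c.M 3 * x * y ^ 3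
          + c.M 4 * y ^ 4)) := by
  have three : (3 : K) = 0 := CharP.cast_eq_zero K 3
  simp [quartic, hc.a1, hc.a2, hc.b1, hc.b2, pureA, pureB]
  linear_combination (x * c.a 3 + y * c.b 3) * (s ^ 2 * z ^ 2 * m + s * z * m ^ 2) * three

/-- The restriction of the quartic to the span of `(0, 0, 1, 0)` and `(x, y, 0, n)`. -/
theorem eval_quartic_infinity {c : LineCoeffs K} (hc : c.IsPure) (x y n z : K) :
    eval ![x, y, z, n] c.quartic =
      (x * c.a 3 + y * c.b 3) * z ^ 3
      + (x ^ 2 * c.Q 0 2 + x * y * c.Q 1 2 + y ^ 2 * c.Q 2 2) * z ^ 2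
      + ((x ^ 2 * c.Q 0 1 + x * y * c.Q 1 1 + y ^ 2 * c.Q 2 1) * n
        + (x ^ 3 * c.L 0 1 + x ^ 2 * y * c.L 1 1 + x * y ^ 2 * c.L 2 1 + y ^ 3 * c.L 3 1)) * z
      + ((x * c.a 0 + y * c.b 0) * n ^ 3
        + (x ^ 2 * c.Q 0 0 + x * y * c.Q 1 0 + y ^ 2 * c.Q 2 0) * n ^ 2
        + (x ^ 3 * c.L 0 0 + x ^ 2 * y * c.L 1 0 + x * y ^ 2 * c.L 2 0 + y ^ 3 * c.L 3 0) * n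
        + (c.M 0 * x ^ 4 + c.M 1 * x ^ 3 * y + c.M 2 * x ^ 2 * y ^ 2 + c.M 3 * x * y ^ 3
          + c.M 4 * y ^ 4)) := by
  simp [quartic, hc.a1, hc.a2, hc.b1, hc.b2]
  ring

/-- The line through `(0, 0, s, 1)` with direction `(-β, α, m, 0)`. -/
def affineLine (c : LineCoeffs K) (x : (_ : K) × K) : Submodule K (Fin 4 → K) :=
  Submodule.span K {![0, 0, x.1, 1], ![-c.pureB x.1, c.pureA x.1, x.2, 0]}

/-- The line through `(0, 0, 1, 0)` with direction `(-b₃, a₃, 0, n)`. -/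
def infinityLine (c : LineCoeffs K) (n : K) : Submodule K (Fin 4 → K) :=
  Submodule.span K {![0, 0, 1, 0], ![-c.b 3, c.a 3, 0, n]}

/-- The cubic equation for the slopes `m` of the lines `c.affineLine ⟨s, m⟩` on the quartic. -/
noncomputable def affineCubic (c : LineCoeffs K) (s : K) : Polynomial K :=
  Polynomial.C c.det * Polynomial.X ^ 3
  + Polynomial.C (c.pureB s ^ 2 * c.Q 0 2 - c.pureA s * c.pureB s * c.Q 1 2
    + c.pureA s ^ 2 * c.Q 2 2) * Polynomial.X ^ 2
  + Polynomial.C (-c.pureB s ^ 3 * c.L 0 1 + c.pureB s ^ 2 * c.pureA s * c.L 1 1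
    - c.pureB s * c.pureA s ^ 2 * c.L 2 1 + c.pureA s ^ 3 * c.L 3 1) * Polynomial.X
  + Polynomial.C (c.M 0 * c.pureB s ^ 4 - c.M 1 * c.pureB s ^ 3 * c.pureA s
    + c.M 2 * c.pureB s ^ 2 * c.pureA s ^ 2 - c.M 3 * c.pureB s * c.pureA s ^ 3
    + c.M 4 * c.pureA s ^ 4)

/-- The cubic equation for the slopes `n` of the lines `c.infinityLine n` on the quartic. -/
noncomputable def infinityCubic (c : LineCoeffs K) : Polynomial K :=
  Polynomial.C (-c.det) * Polynomial.X ^ 3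
  + Polynomial.C (c.tangentCoeff 2 0) * Polynomial.X ^ 2
  + Polynomial.C (-c.b 3 ^ 3 * c.L 0 0 + c.b 3 ^ 2 * c.a 3 * c.L 1 0
    - c.b 3 * c.a 3 ^ 2 * c.L 2 0 + c.a 3 ^ 3 * c.L 3 0) * Polynomial.X
  + Polynomial.C (c.M 0 * c.b 3 ^ 4 - c.M 1 * c.b 3 ^ 3 * c.a 3
    + c.M 2 * c.b 3 ^ 2 * c.a 3 ^ 2 - c.M 3 * c.b 3 * c.a 3 ^ 3 + c.M 4 * c.a 3 ^ 4)

theorem natDegree_affineCubic {c : LineCoeffs K} (h : c.det ≠ 0) (s : K) :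
    (c.affineCubic s).natDegree = 3 := Polynomial.natDegree_cubic h

theorem natDegree_infinityCubic {c : LineCoeffs K} (h : c.det ≠ 0) :
    c.infinityCubic.natDegree = 3 := Polynomial.natDegree_cubic (neg_ne_zero.mpr h)

/-- Two vectors orthogonal to the same nonzero vector of `K²` are proportional. -/
theorem exists_scalar {A B x y : K} (hAB : A ≠ 0 ∨ B ≠ 0) (hxy : x ≠ 0 ∨ y ≠ 0)
    (h : x * A + y * B = 0) : ∃ k : K, k ≠ 0 ∧ k * x = -B ∧ k * y = A := by
  by_cases hA : A = 0
  · subst hA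
    have hB : B ≠ 0 := by simpa using hAB
    have hy : y = 0 := by simpa [hB] using h
    subst hy
    have hx : x ≠ 0 := by simpa using hxy
    exact ⟨-B / x, div_ne_zero (neg_ne_zero.mpr hB) hx, div_mul_cancel₀ _ hx, by simp⟩
  · have hy : y ≠ 0 := by
      rintro rfl
      simp [hA] at h
      simp [h] at hxy
    refine ⟨A / y, div_ne_zero hA hy, ?_, div_mul_cancel₀ _ hy⟩
    field_simp
    linear_combination h

theorem IsPure.a_or_b {c : LineCoeffs K} (hc : c.IsPure) : c.a 3 ≠ 0 ∨ c.b 3 ≠ 0 := by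
  by_contra! h
  exact hc.det_ne_zero (by rw [det, h.1, h.2]; ring)

theorem IsPure.pureA_or_pureB {c : LineCoeffs K} (hc : c.IsPure) (s : K) :
    c.pureA s ≠ 0 ∨ c.pureB s ≠ 0 := by
  by_contra! h
  obtain ⟨hA, hB⟩ := h
  rw [pureA] at hA
  rw [pureB] at hB
  exact hc.det_ne_zero (by rw [det]; linear_combination c.b 3 * hA - c.a 3 * hB)

/-- Classification of the lines on the quartic that meet the line `x₀ = x₁ = 0`. -/
theorem line_cases [CharP K 3] [Infinite K] {c : LineCoeffs K} (hc : c.IsPure)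
    {m : Submodule K (Fin 4 → K)} (hm : IsLineOn c.quartic m) {p w : Fin 4 → K}
    (hp : p ∈ m) (hw : w ∈ m) (hp0 : p ≠ 0) (hp1 : p 0 = 0 ∧ p 1 = 0) (hw1 : w 0 ≠ 0 ∨ w 1 ≠ 0) :
    (∃ s n : K, m = c.affineLine ⟨s, n⟩ ∧ c.tangentPoly.IsRoot s ∧
      c.tangentPoly.derivative.eval s * n + c.cuspPoly.eval s = 0 ∧ (c.affineCubic s).IsRoot n) ∨
    (∃ n : K, m = c.infinityLine n ∧ c.tangentCoeff 2 2 = 0 ∧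
      c.tangentCoeff 2 1 * n + c.cuspCoeff 3 1 = 0 ∧ c.infinityCubic.IsRoot n) := by
  by_cases hp3 : p 3 = 0
  · right
    have hp2 : p 2 ≠ 0 := by
      intro h
      exact hp0 (by funext i; fin_cases i <;> simp [hp1, hp3, h])
    have he : (![0, 0, 1, 0] : Fin 4 → K) ∈ m := by
      convert m.smul_mem (p 2)⁻¹ hp using 1
      funext i
      fin_cases i <;> simp [hp1, hp3, hp2]
    have hw' : (![w 0, w 1, 0, w 3] : Fin 4 → K) ∈ m := by
      convert m.sub_mem hw (m.smul_mem (w 2) he) using 1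
      funext i
      fin_cases i <;> simp
    have hline (x y n : K) (h : ![x, y, 0, n] ∈ m) (z : K) : eval ![x, y, z, n] c.quartic = 0 := by
      refine hm.eval_eq_zero _ ?_
      convert m.add_mem (m.smul_mem z he) h using 1
      funext i
      fin_cases i <;> simp
    -- Vanishing of the z³ coefficient fixes (w₀, w₁) up to scale. After rescaling, the three lower
    -- coefficients are the three asserted conditions. The affine case below follows the same
    -- pattern.
    have h1 := fun z => (eval_quartic_infinity hc _ _ _ z).symm.trans (hline _ _ _ hw' z)
    obtain ⟨k, hk, hkx, hky⟩ := exists_scalar hc.a_or_b hw1 (cubic_coeffs_eq_zero h1).1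
    have hw'' : (![-c.b 3, c.a 3, 0, k * w 3] : Fin 4 → K) ∈ m := by
      convert m.smul_mem k hw' using 1
      funext i
      fin_cases i <;> simp [hkx, hky]
    have h2 := fun z => (eval_quartic_infinity hc _ _ _ z).symm.trans (hline _ _ _ hw'' z)
    obtain ⟨-, e2, e1, e0⟩ := cubic_coeffs_eq_zero h2
    refine ⟨k * w 3, eq_span_pair hm.finrank_eq he hw'' ?_, ?_, ?_, ?_⟩
    · rw [LinearIndependent.pair_iff]
      intro s t hst
      have i0 := congrFun hst 0
      have i1 := congrFun hst 1
      have i2 := congrFun hst 2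
      simp at i0 i1 i2
      refine ⟨i2, ?_⟩
      rcases hc.a_or_b with h | h
      · simpa [h] using i1
      · simpa [h] using i0
    · simp only [tangentCoeff, Matrix.cons_val]
      linear_combination e2
    · simp only [tangentCoeff, cuspCoeff, Matrix.cons_val]
      linear_combination e1
    · simp only [infinityCubic, tangentCoeff, det, Polynomial.IsRoot, Polynomial.eval_add,
        Polynomial.eval_mul, Polynomial.eval_C, Polynomial.eval_pow, Polynomial.eval_X,
        Matrix.cons_val]
      linear_combination e0
  · left
    set s := p 2 / p 3 with hs
    have he : (![0, 0, s, 1] : Fin 4 → K) ∈ m := by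
      convert m.smul_mem (p 3)⁻¹ hp using 1
      funext i
      fin_cases i <;> simp [hp1, hp3, hs, div_eq_inv_mul]
    have hw' : (![w 0, w 1, w 2 - w 3 * s, 0] : Fin 4 → K) ∈ m := by
      convert m.sub_mem hw (m.smul_mem (w 3) he) using 1
      funext i
      fin_cases i <;> simp
    have hline (x y n : K) (h : ![x, y, n, 0] ∈ m) (z : K) :
        eval ![x, y, s * z + n, z] c.quartic = 0 := by
      refine hm.eval_eq_zero _ ?_
      convert m.add_mem (m.smul_mem z he) h using 1
      funext i
      fin_cases i <;> simp [mul_comm]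
    have h1 := fun z => (eval_quartic_affine hc _ _ _ _ z).symm.trans (hline _ _ _ hw' z)
    obtain ⟨k, hk, hkx, hky⟩ :=
      exists_scalar (hc.pureA_or_pureB s) hw1 (cubic_coeffs_eq_zero h1).1
    have hw'' : (![-c.pureB s, c.pureA s, k * (w 2 - w 3 * s), 0] : Fin 4 → K) ∈ m := by
      convert m.smul_mem k hw' using 1
      funext i
      fin_cases i <;> simp [hkx, hky]
    have h2 := fun z => (eval_quartic_affine hc _ _ _ _ z).symm.trans (hline _ _ _ hw'' z)
    obtain ⟨-, e2, e1, e0⟩ := cubic_coeffs_eq_zero h2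
    refine ⟨s, k * (w 2 - w 3 * s), eq_span_pair hm.finrank_eq he hw'' ?_, ?_, ?_, ?_⟩
    · rw [LinearIndependent.pair_iff]
      intro u t hst
      have i0 := congrFun hst 0
      have i1 := congrFun hst 1
      have i3 := congrFun hst 3
      simp at i0 i1 i3
      refine ⟨i3, ?_⟩
      rcases hc.pureA_or_pureB s with h | h
      · simpa [h] using i1
      · simpa [h] using i0
    · rw [Polynomial.IsRoot, eval_tangentPoly]
      linear_combination e2
    · rw [eval_derivative_tangentPoly, eval_cuspPoly]
      linear_combination e1
    · have hd : -c.pureB s * c.a 3 + c.pureA s * c.b 3 = c.det := by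
        rw [pureA, pureB, det]
        ring
      rw [hd] at e0
      simp only [affineCubic, Polynomial.IsRoot, Polynomial.eval_add,
        Polynomial.eval_mul, Polynomial.eval_C, Polynomial.eval_pow, Polynomial.eval_X]
      linear_combination e0

/-- If the polynomial `tangentPoly` is not zero, at most 12 lines on the quartic meet the line
`x₀ = x₁ = 0`. -/
theorem encard_lines_le [CharP K 3] [Infinite K] {c : LineCoeffs K} (hc : c.IsPure)
    (hf : c.tangentPoly ≠ 0) :
    {m : Submodule K (Fin 4 → K) | IsLineOn c.quartic m ∧
      (∃ p ∈ m, p ≠ 0 ∧ p 0 = 0 ∧ p 1 = 0) ∧ ∃ w ∈ m, w 0 ≠ 0 ∨ w 1 ≠ 0}.encard ≤ 12 := by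
  classical
  let N : K → Finset K := fun s => (c.affineCubic s).roots.toFinset.filter fun n =>
    c.tangentPoly.derivative.eval s * n + c.cuspPoly.eval s = 0
  let Ninf : Finset K := c.infinityCubic.roots.toFinset.filter fun n =>
    c.tangentCoeff 2 2 = 0 ∧ c.tangentCoeff 2 1 * n + c.cuspCoeff 3 1 = 0
  have hroots (g : Polynomial K) (hg : g.natDegree = 3) : g.roots.toFinset.card ≤ 3 :=
    (Multiset.toFinset_card_le _).trans (hg ▸ g.card_roots')
  have hne (g : Polynomial K) (hg : g.natDegree = 3) : g ≠ 0 := by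
    rintro rfl
    simp at hg
  have honly {x y : K} (hx : x ≠ 0) (T : Finset K) (hT : ∀ n ∈ T, x * n + y = 0) : T.card ≤ 1 := by
    refine Finset.card_le_one.mpr fun n hn n' hn' => mul_left_cancel₀ hx ?_
    linear_combination hT n hn - hT n' hn'
  have hfin : 2 * ∑ s ∈ c.tangentPoly.roots.toFinset, (N s).card ≤ 3 * c.tangentPoly.natDegree :=
    two_mul_sum_card_le _ hf N
      (fun s => (Finset.card_filter_le _ _).trans
        (hroots _ (natDegree_affineCubic hc.det_ne_zero s)))
      (fun s hs => honly hs _ fun n hn => (Finset.mem_filter.mp hn).2)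
  -- The point at infinity is a zero of f, viewed as a form of degree 8, of multiplicity 8 - deg f.
  -- Its multiplicity is at least 1 when the top coefficient vanishes and at least 2 when the next
  -- one does too, so it obeys the same weighted bound.
  have hinf : 2 * Ninf.card + 3 * c.tangentPoly.natDegree ≤ 24 := by
    have h8 := c.natDegree_tangentPoly_le
    have hlt (k j : Fin 3) (h : c.tangentCoeff k j = 0) :
        c.tangentPoly.natDegree ≠ 3 * (k : ℕ) + j := by
      intro hd
      apply hf
      rw [← Polynomial.leadingCoeff_eq_zero, Polynomial.leadingCoeff, hd, coeff_tangentPoly, h]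
    have h3 : Ninf.card ≤ 3 := (Finset.card_filter_le _ _).trans
        (hroots _ (natDegree_infinityCubic hc.det_ne_zero))
    by_cases h22 : c.tangentCoeff 2 2 = 0
    · have d8 := hlt 2 2 h22
      by_cases h21 : c.tangentCoeff 2 1 = 0
      · have d7 := hlt 2 1 h21
        simp at d7 d8
        omega
      · have := honly h21 Ninf fun n hn => (Finset.mem_filter.mp hn).2.2
        simp at d8
        omega
    · have : Ninf = ∅ := Finset.filter_false_of_mem fun n _ h => h22 h.1
      simp only [this, Finset.card_empty]
      omega
  let T : Finset (Submodule K (Fin 4 → K)) :=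
    (c.tangentPoly.roots.toFinset.sigma N).image c.affineLine ∪ Ninf.image c.infinityLine
  have hT : T.card ≤ 12 := by
    have h1 : T.card ≤ _ := Finset.card_union_le _ _
    have h2 := Finset.card_image_le (s := c.tangentPoly.roots.toFinset.sigma N) (f := c.affineLine)
    have h3 := Finset.card_image_le (s := Ninf) (f := c.infinityLine)
    rw [Finset.card_sigma] at h2
    omega
  refine le_trans (Set.encard_le_encard (t := (T : Set (Submodule K (Fin 4 → K)))) ?_) ?_
  · rintro m ⟨hm, ⟨p, hp, hp0, hp1⟩, w, hw, hw1⟩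
    rw [Finset.mem_coe, Finset.mem_union]
    rcases line_cases hc hm hp hw hp0 hp1 hw1 with ⟨s, n, rfl, h1, h2, h3⟩ | ⟨n, rfl, h1, h2, h3⟩
    · left
      refine Finset.mem_image_of_mem _ (Finset.mem_sigma.mpr ⟨?_, Finset.mem_filter.mpr ⟨?_, h2⟩⟩)
      · simpa [hf] using h1
      · have := hne _ (natDegree_affineCubic hc.det_ne_zero s)
        simpa [this] using h3
    · right
      refine Finset.mem_image_of_mem _ (Finset.mem_filter.mpr ⟨?_, h1, h2⟩)
      have := hne _ (natDegree_infinityCubic hc.det_ne_zero)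
      simpa [this] using h3
  · rw [Set.encard_coe_eq_coe_finsetCard]
    exact_mod_cast hT

end Lines

end LineCoeffs

variable {K : Type*} [Field K]

/-! ### Transport to coordinates adapted to the line -/

section Adapted

open MvPolynomial

theorem IsAdapted.mulVec_mem_iff {A : GL (Fin 4) K} {ℓ : Submodule K (Fin 4 → K)}
    (hA : IsAdapted A ℓ) (v : Fin 4 → K) :
    (A : Matrix (Fin 4) (Fin 4) K).mulVec v ∈ ℓ ↔ v 0 = 0 ∧ v 1 = 0 := by
  rw [show ℓ = _ from hA, Submodule.mem_span_pair]
  constructor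
  · rintro ⟨a, b, h⟩
    rw [← Matrix.mulVec_smul, ← Matrix.mulVec_smul, ← Matrix.mulVec_add] at h
    rw [← mulVec_injective A h]
    simp
  · rintro ⟨h0, h1⟩
    refine ⟨v 2, v 3, ?_⟩
    rw [← Matrix.mulVec_smul, ← Matrix.mulVec_smul, ← Matrix.mulVec_add]
    congr 1
    funext i
    fin_cases i <;> simp [h0, h1]

theorem IsAdapted.exists_lineCoeffs [Infinite K] {A : GL (Fin 4) K} {ℓ : Submodule K (Fin 4 → K)}
    (hA : IsAdapted A ℓ) {F : MvPolynomial (Fin 4) K} (hF : F.IsHomogeneous 4)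
    (hℓ : IsLineOn F ℓ) : ∃ c : LineCoeffs K, coords A F = c.quartic := by
  refine QuarticLines.exists_lineCoeffs (isHomogeneous_coords A hF) fun u => ?_
  rw [eval_coords]
  exact hℓ.eval_eq_zero _ ((hA.mulVec_mem_iff _).mpr (by simp))

theorem IsLineOn.comap {A : GL (Fin 4) K} {F : MvPolynomial (Fin 4) K}
    {m : Submodule K (Fin 4 → K)} (hm : IsLineOn F m) :
    IsLineOn (coords A F) (m.comap (A : Matrix (Fin 4) (Fin 4) K).mulVecLin) := by
  refine ⟨?_, fun v hv => ?_⟩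
  · have h := (Submodule.equivMapOfInjective (A : Matrix (Fin 4) (Fin 4) K).mulVecLin
      (mulVec_injective A) (m.comap (A : Matrix (Fin 4) (Fin 4) K).mulVecLin)).finrank_eq
    rw [h, Submodule.map_comap_eq_of_surjective (fun w => exists_mulVec_eq A w), hm.finrank_eq]
  · rw [eval_coords]
    exact hm.eval_eq_zero _ hv

/-- Pulling lines back by A is injective and preserves incidence with ℓ. A line other than ℓ
contains a vector outside ℓ, which supplies the direction needed for the count. -/
theorem valency_le_twelve [CharP K 3] [Infinite K] {A : GL (Fin 4) K}
    {ℓ : Submodule K (Fin 4 → K)} (hA : IsAdapted A ℓ) {F : MvPolynomial (Fin 4) K}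
    (hℓ : IsLineOn F ℓ) {c : LineCoeffs K} (hG : coords A F = c.quartic) (hc : c.IsPure)
    (hf : c.tangentPoly ≠ 0) : valency F ℓ ≤ 12 := by
  refine le_trans ?_ (LineCoeffs.encard_lines_le hc hf)
  refine Set.encard_le_encard_of_injOn
    (f := fun m => m.comap (A : Matrix (Fin 4) (Fin 4) K).mulVecLin) ?_
    (Submodule.comap_injective_of_surjective (fun w => exists_mulVec_eq A w)).injOn
  rintro m ⟨hm, hne, P, ⟨hPm, hPℓ⟩, -⟩
  have hrep : P.rep ∈ P.submodule := by
    rw [P.submodule_eq]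
    exact Submodule.mem_span_singleton_self _
  refine ⟨hG ▸ hm.comap, ?_, ?_⟩
  · obtain ⟨p, hp⟩ := exists_mulVec_eq A P.rep
    refine ⟨p, ?_, ?_, ?_⟩
    · rw [Submodule.mem_comap, Matrix.mulVecLin_apply, hp]
      exact hPm hrep
    · rintro rfl
      rw [Matrix.mulVec_zero] at hp
      exact P.rep_nonzero hp.symm
    · rw [← hA.mulVec_mem_iff, hp]
      exact hPℓ hrep
  · by_contra! h
    refine hne (Submodule.eq_of_le_of_finrank_eq (fun x hx => ?_)
      (hm.finrank_eq.trans hℓ.finrank_eq.symm))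
    obtain ⟨w, rfl⟩ := exists_mulVec_eq A x
    rw [hA.mulVec_mem_iff]
    exact h w hx

end Adapted

/-! ### Zariski closures of subsets of a line -/

section ZariskiClosure

open MvPolynomial

theorem polynomial_eval_aeval {σ : Type*} (f : σ → Polynomial K) (G : MvPolynomial σ K) (s : K) :
    (aeval f G).eval s = eval (fun i => (f i).eval s) G := by
  induction G using MvPolynomial.induction_on with
  | C a => simp
  | add p q hp hq => simp [hp, hq]
  | mul_X p i hp => simp [hp]

/-- A form that vanishes at infinitely many points of the line `x₀ = x₁ = 0` vanishes on it. -/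
theorem eval_eq_zero_of_infinite [Infinite K] {G : MvPolynomial (Fin 4) K} {n : ℕ}
    (hG : G.IsHomogeneous n) (h : {s | eval ![0, 0, s, 1] G = 0}.Infinite) (u v : K) :
    eval ![0, 0, u, v] G = 0 := by
  have h1 (s : K) : eval ![0, 0, s, 1] G = 0 := by
    have e (s : K) : (aeval ![0, 0, Polynomial.X, 1] G : Polynomial K).eval s =
        eval ![0, 0, s, 1] G := by
      rw [polynomial_eval_aeval]
      congr 2
      funext i
      fin_cases i <;> simp
    have : (aeval ![0, 0, Polynomial.X, 1] G : Polynomial K) = 0 := by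
      refine Polynomial.eq_zero_of_infinite_isRoot _ (h.mono fun s hs => ?_)
      rw [Set.mem_ofPred_eq, Polynomial.IsRoot, e]
      exact hs
    rw [← e, this, Polynomial.eval_zero]
  have e (v : K) : (aeval ![0, 0, Polynomial.C u, Polynomial.X] G : Polynomial K).eval v =
      eval ![0, 0, u, v] G := by
    rw [polynomial_eval_aeval]
    congr 2
    funext i
    fin_cases i <;> simp
  have : (aeval ![0, 0, Polynomial.C u, Polynomial.X] G : Polynomial K) = 0 := by
    -- Homogeneity handles v ≠ 0; as a polynomial in v with infinitely many roots is zero, v = 0 is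
    -- covered as well.
    refine Polynomial.eq_zero_of_infinite_isRoot _
      ((Set.finite_singleton (0 : K)).infinite_compl.mono fun v hv => ?_)
    have hv : v ≠ 0 := by simpa using hv
    rw [Set.mem_ofPred_eq, Polynomial.IsRoot, e]
    have : ![0, 0, u, v] = v • ![0, 0, u / v, 1] := by
      funext i
      fin_cases i <;> simp [mul_div_cancel₀ _ hv]
    rw [this, eval_smul_of_isHomogeneous hG, h1, mul_zero]
  rw [← e, this, Polynomial.eval_zero]

theorem eval_coords_inv (A : GL (Fin 4) K) (G : MvPolynomial (Fin 4) K) (v : Fin 4 → K) :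
    eval ((A : Matrix (Fin 4) (Fin 4) K).mulVec v) (coords A⁻¹ G) = eval v G := by
  rw [← eval_coords, ← coords_mul, inv_mul_cancel, coords_one]

theorem subset_zariskiClosure (T : Set (ℙ K (Fin 4 → K))) : T ⊆ zariskiClosure T :=
  fun P hP _ _ _ h => h P hP

/-- The parameters `s` of those points `[0 : 0 : s : 1]`, in the coordinates given by `A`, that
belong to `T`. -/
def lineParameters (A : GL (Fin 4) K) (T : Set (ℙ K (Fin 4 → K))) : Set K :=
  {s | ∃ P ∈ T, P.submodule = K ∙ ((A : Matrix (Fin 4) (Fin 4) K).mulVec ![0, 0, s, 1])}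

theorem exists_smul_eq_rep {P : ℙ K (Fin 4 → K)} {w : Fin 4 → K} (h : P.submodule = K ∙ w) :
    ∃ a : K, a ≠ 0 ∧ a • w = P.rep := by
  have hrep : P.rep ∈ K ∙ w := by
    rw [← h, P.submodule_eq]
    exact Submodule.mem_span_singleton_self _
  obtain ⟨a, ha⟩ := Submodule.mem_span_singleton.mp hrep
  refine ⟨a, ?_, ha⟩
  rintro rfl
  exact P.rep_nonzero (by rw [← ha, zero_smul])

theorem mem_points_iff {P : ℙ K (Fin 4 → K)} {ℓ : Submodule K (Fin 4 → K)} :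
    P ∈ points ℓ ↔ P.rep ∈ ℓ := by
  rw [points, Set.mem_ofPred_eq, P.submodule_eq, Submodule.span_singleton_le_iff_mem]

/-- The linear forms x₀, x₁ bound the closure from above; from below, a form with infinitely many
zeros on a line vanishes on all of it. -/
theorem zariskiClosure_eq_points [Infinite K] {A : GL (Fin 4) K} {ℓ : Submodule K (Fin 4 → K)}
    (hA : IsAdapted A ℓ) {T : Set (ℙ K (Fin 4 → K))} (hT : T ⊆ points ℓ)
    (hinf : (lineParameters A T).Infinite) : zariskiClosure T = points ℓ := by
  apply Set.Subset.antisymm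
  · intro P hP
    obtain ⟨v, hv⟩ := exists_mulVec_eq A P.rep
    have key (k : Fin 4) (hk : ∀ w : Fin 4 → K, w 0 = 0 ∧ w 1 = 0 → w k = 0) : v k = 0 := by
      have := hP 1 (coords A⁻¹ (X k)) (isHomogeneous_coords _ (isHomogeneous_X K k)) fun P' hP' => by
        obtain ⟨w, hw⟩ := exists_mulVec_eq A P'.rep
        have hmem := mem_points_iff.mp (hT hP')
        rw [← hw, hA.mulVec_mem_iff] at hmem
        rw [← hw, eval_coords_inv, eval_X, hk w hmem]
      rwa [← hv, eval_coords_inv, eval_X] at this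
    rw [mem_points_iff, ← hv, hA.mulVec_mem_iff]
    exact ⟨key 0 fun w h => h.1, key 1 fun w h => h.2⟩
  · intro P hP n H hH hvan
    obtain ⟨v, hv⟩ := exists_mulVec_eq A P.rep
    rw [mem_points_iff, ← hv, hA.mulVec_mem_iff] at hP
    rw [← hv, ← eval_coords]
    have : v = ![0, 0, v 2, v 3] := by
      funext i
      fin_cases i <;> simp [hP]
    rw [this]
    refine eval_eq_zero_of_infinite (isHomogeneous_coords A hH) (hinf.mono ?_) _ _
    rintro s ⟨P', hP', h⟩
    obtain ⟨a, ha, hrep⟩ := exists_smul_eq_rep h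
    have := hvan P' hP'
    rw [← hrep, eval_smul_of_isHomogeneous hH, ← eval_coords] at this
    exact (mul_eq_zero.mp this).resolve_left (pow_ne_zero n ha)

theorem infinite_lineParameters [Infinite K] {A : GL (Fin 4) K} {ℓ : Submodule K (Fin 4 → K)}
    (hA : IsAdapted A ℓ) {T : Set (ℙ K (Fin 4 → K))} (hT : zariskiClosure T = points ℓ) :
    (lineParameters A T).Infinite := by
  intro hfin
  -- This form vanishes at the finitely many given points of the line and at [0 : 0 : 1 : 0], which
  -- has no parameter, but not on the whole line.
  let H₀ : MvPolynomial (Fin 4) K := X 3 * ∏ s ∈ hfin.toFinset, (X 2 - C s * X 3)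
  have hH₀ : H₀.IsHomogeneous (1 + ∑ s ∈ hfin.toFinset, 1) :=
    (isHomogeneous_X K 3).mul (IsHomogeneous.prod _ _ _ fun s _ =>
      (isHomogeneous_X K 2).sub ((isHomogeneous_X K 3).C_mul s))
  have heval (v : Fin 4 → K) : eval v H₀ = v 3 * ∏ s ∈ hfin.toFinset, (v 2 - s * v 3) := by
    simp [H₀, map_prod]
  have hvan : ∀ P ∈ T, eval P.rep (coords A⁻¹ H₀) = 0 := by
    intro P hP
    obtain ⟨v, hv⟩ := exists_mulVec_eq A P.rep
    have hmem := mem_points_iff.mp (hT ▸ subset_zariskiClosure T hP)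
    rw [← hv, hA.mulVec_mem_iff] at hmem
    rw [← hv, eval_coords_inv, heval]
    by_cases h3 : v 3 = 0
    · rw [h3, zero_mul]
    · refine mul_eq_zero_of_right _ (Finset.prod_eq_zero (i := v 2 / v 3) ?_ ?_)
      · rw [Set.Finite.mem_toFinset]
        refine ⟨P, hP, ?_⟩
        have : v = v 3 • ![0, 0, v 2 / v 3, 1] := by
          funext i
          fin_cases i <;> simp [hmem, mul_div_cancel₀ _ h3]
        have hAv := (congrArg (A : Matrix (Fin 4) (Fin 4) K).mulVec this).trans
          (Matrix.mulVec_smul _ _ _)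
        rw [P.submodule_eq, ← hv, hAv, Submodule.span_singleton_smul_eq (IsUnit.mk0 _ h3)]
      · rw [div_mul_cancel₀ _ h3, sub_self]
  obtain ⟨s, hs⟩ := hfin.infinite_compl.nonempty
  have hne : (![0, 0, s, 1] : Fin 4 → K) ≠ 0 := fun h => by simpa using congrFun h 3
  let P : ℙ K (Fin 4 → K) := .mk K _ (mulVec_ne_zero A hne)
  have hP : P.submodule = K ∙ ((A : Matrix (Fin 4) (Fin 4) K).mulVec ![0, 0, s, 1]) :=
    Projectivization.submodule_mk _ _
  obtain ⟨a, ha, hrep⟩ := exists_smul_eq_rep hP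
  have hmem : P ∈ points ℓ := by
    rw [mem_points_iff, ← hrep]
    exact ℓ.smul_mem a ((hA.mulVec_mem_iff _).mpr (by simp))
  rw [← hT] at hmem
  have := hmem _ _ (isHomogeneous_coords A⁻¹ hH₀) hvan
  rw [← hrep, ← Matrix.mulVec_smul, eval_coords_inv, heval] at this
  simp only [Pi.smul_apply, smul_eq_mul, Matrix.cons_val, mul_one] at this
  rcases mul_eq_zero.mp this with h | h
  · exact ha h
  · obtain ⟨r, hr, h⟩ := Finset.prod_eq_zero_iff.mp h
    have hsr : s = r := by
      refine mul_left_cancel₀ ha ?_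
      linear_combination h
    exact hs (hsr ▸ (Set.Finite.mem_toFinset hfin).mp hr)

end ZariskiClosure

namespace LineCoeffs

variable {K : Type*} [Field K]

/-! ### Residual cubics -/

section Residual

open MvPolynomial

/-- The residual cubic in the plane `x₀ = t x₁`, explicitly. -/
theorem residualCubic_quartic (c : LineCoeffs K) (t : K) :
    residualCubic c.quartic t =
      C (t * c.a 0 + c.b 0) * X 2 ^ 3 + C (t * c.a 1 + c.b 1) * X 1 * X 2 ^ 2
      + C (t * c.a 2 + c.b 2) * X 1 ^ 2 * X 2 + C (t * c.a 3 + c.b 3) * X 1 ^ 3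
      + X 0 * (C (t ^ 2 * c.Q 0 0 + t * c.Q 1 0 + c.Q 2 0) * X 2 ^ 2
        + C (t ^ 2 * c.Q 0 1 + t * c.Q 1 1 + c.Q 2 1) * X 1 * X 2
        + C (t ^ 2 * c.Q 0 2 + t * c.Q 1 2 + c.Q 2 2) * X 1 ^ 2)
      + X 0 ^ 2 * (C (t ^ 3 * c.L 0 0 + t ^ 2 * c.L 1 0 + t * c.L 2 0 + c.L 3 0) * X 2
        + C (t ^ 3 * c.L 0 1 + t ^ 2 * c.L 1 1 + t * c.L 2 1 + c.L 3 1) * X 1)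
      + C (t ^ 4 * c.M 0 + t ^ 3 * c.M 1 + t ^ 2 * c.M 2 + t * c.M 3 + c.M 4) * X 0 ^ 3 := by
  -- After the substitution the quartic is exactly the variable x₁ of the plane, numbered 0, times
  -- the cubic, so the division leaves no remainder.
  refine Eq.trans (congrArg (divMonomial · _) ?_) (X_mul_divMonomial 0 _)
  simp [quartic]
  ring

end Residual

end LineCoeffs

/-! ### A normal form for cuspidal plane cubics -/

section CuspidalCubic

open MvPolynomial

variable {K : Type*} [Field K]

/-- The polynomial is linear in x₂, with coefficient x₀² prime to the constant term r x₁³. -/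
theorem irreducible_cuspidal_normalForm {r : K} (hr : r ≠ 0) :
    Irreducible (X 0 ^ 2 * X 2 + C r * X 1 ^ 3 : MvPolynomial (Fin 3) K) := by
  refine irreducible_mul_X_add _ _ 2 (pow_ne_zero 2 (X_ne_zero 0)) ?_ ?_ ?_
  · intro h
    simpa [vars_X] using vars_pow _ _ h
  · intro h
    rw [vars_C_mul _ hr] at h
    simpa [vars_X] using vars_pow _ _ h
  · refine IsRelPrime.pow_left ?_
    rw [(X_prime (i := 0)).irreducible.isRelPrime_iff_not_dvd]
    rintro ⟨q, hq⟩
    have := congrArg (eval ![0, 1, 0]) hq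
    simp [hr] at this

/-- The plane cubic `r (x₁ - s x₂)³ + x₀² (b₀ x₂ + b₁ x₁) + m x₀³`. -/
noncomputable def cuspidalCubic (r s b₀ b₁ m : K) : MvPolynomial (Fin 3) K :=
  C r * (X 1 - C s * X 2) ^ 3 + X 0 ^ 2 * (C b₀ * X 2 + C b₁ * X 1) + C m * X 0 ^ 3

/-- The cubic is the image of the normal form under a linear substitution with inverse ψ;
invertibility is the condition b₀ + b₁s ≠ 0. -/
theorem irreducible_cuspidalCubic {r s b₀ b₁ m : K} (hr : r ≠ 0) (hk : b₀ + b₁ * s ≠ 0) :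
    Irreducible (cuspidalCubic r s b₀ b₁ m) := by
  have hCk : (C (b₀ + b₁ * s)⁻¹ : MvPolynomial (Fin 3) K) * (C b₀ + C b₁ * C s) = 1 := by
    rw [← C_mul, ← C_add, ← C_mul, inv_mul_cancel₀ hk, C_1]
  let φ : MvPolynomial (Fin 3) K →ₐ[K] MvPolynomial (Fin 3) K :=
    aeval ![X 0, X 1 - C s * X 2, C b₀ * X 2 + C b₁ * X 1 + C m * X 0]
  let ψ : MvPolynomial (Fin 3) K →ₐ[K] MvPolynomial (Fin 3) K :=
    aeval ![X 0, X 1 + C s * (C (b₀ + b₁ * s)⁻¹ * (X 2 - C b₁ * X 1 - C m * X 0)),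
      C (b₀ + b₁ * s)⁻¹ * (X 2 - C b₁ * X 1 - C m * X 0)]
  have hφψ : φ.comp ψ = AlgHom.id K _ := by
    ext1 i
    fin_cases i <;> simp [φ, ψ]
    · linear_combination (C s * X 2) * hCk
    · linear_combination (X 2) * hCk
  have hψφ : ψ.comp φ = AlgHom.id K _ := by
    ext1 i
    fin_cases i <;> simp [φ, ψ]
    linear_combination (X 2 - C b₁ * X 1 - C m * X 0) * hCk
  have h := (MulEquiv.irreducible_iff (AlgEquiv.ofAlgHom φ ψ hφψ hψφ)).mpr
    (irreducible_cuspidal_normalForm hr)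
  convert h using 1
  simp [cuspidalCubic, φ]
  ring

/-- The cube of x₁ - s x₂ contributes nothing to the gradient or Hessian at (0, s, 1). The term with
factor x₀² leaves the single Hessian entry 2(b₀ + b₁s). -/
theorem isCusp_cuspidalCubic [CharP K 3] {r s b₀ b₁ m : K} (hk : b₀ + b₁ * s ≠ 0) :
    IsCusp (cuspidalCubic r s b₀ b₁ m) ![0, s, 1] := by
  have three : (3 : K) = 0 := CharP.cast_eq_zero K 3
  have two : (2 : K) ≠ 0 := fun h => one_ne_zero (α := K) (by linear_combination three - h)
  refine ⟨fun h => by simpa using congrFun h 2, by simp [cuspidalCubic], fun i => ?_, ?_⟩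
  · fin_cases i <;> simp [cuspidalCubic, pderiv_X]
  · have hd : (Matrix.of fun i j => eval ![0, s, 1]
        (pderiv i (pderiv j (cuspidalCubic r s b₀ b₁ m)))) =
        Matrix.diagonal ![(b₀ + b₁ * s) * 2, 0, 0] := by
      ext i j
      fin_cases i <;> fin_cases j <;> simp [cuspidalCubic, pderiv_X]
    classical
    rw [hd, Matrix.rank_diagonal, Fintype.card_eq_one_iff]
    refine ⟨⟨0, by simpa using ⟨hk, two⟩⟩, ?_⟩
    rintro ⟨i, hi⟩
    fin_cases i <;> simp at hi ⊢

/-- The derivative in the direction (0, s, 1) kills x₀ and x₁ - s x₂, so at p it equals p₀²(b₀ +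
b₁s). -/
theorem eq_zero_of_isCusp_cuspidalCubic [CharP K 3] {r s b₀ b₁ m : K} (hk : b₀ + b₁ * s ≠ 0)
    {p : Fin 3 → K} (hp : IsCusp (cuspidalCubic r s b₀ b₁ m) p) : p 0 = 0 := by
  have three : (3 : K) = 0 := CharP.cast_eq_zero K 3
  have h1 := hp.2.2.1 1
  have h2 := hp.2.2.1 2
  simp [cuspidalCubic, pderiv_X] at h1 h2
  by_contra h
  refine hk ((mul_eq_zero.mp (?_ : p 0 ^ 2 * (b₀ + b₁ * s) = 0)).resolve_left (pow_ne_zero 2 h))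
  linear_combination h2 + s * h1

end CuspidalCubic

namespace LineCoeffs

variable {K : Type*} [Field K]

/-! ### The general residual cubic of a pure quartic -/

section General

open MvPolynomial

/-- Over an algebraically closed field of characteristic 3, if the parts of degree 2 and 3 in
`x₀, x₁` vanish, the quartic is singular along a curve. -/
theorem exists_isSingularVector [IsAlgClosed K] [CharP K 3] {c : LineCoeffs K} (hc : c.IsPure)
    (hQ : c.Q = 0) (hL : c.L = 0) (s : K) :
    ∃ v : Fin 4 → K, v 0 = s ∧ v 1 = 1 ∧ IsSingularVector c.quartic v := by
  have three : (3 : K) = 0 := CharP.cast_eq_zero K 3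
  -- m₀, m₁ are the partial derivatives of M at (s, 1). The derivatives in x₂, x₃ vanish in
  -- characteristic 3, so a singular point needs α = -m₀ and β = -m₁: a linear system for y³, z³
  -- with determinant `det`, followed by cube roots. The equation of the surface then follows from
  -- Euler's relation, as 4 = 1.
  set m₀ := 4 * c.M 0 * s ^ 3 + 3 * c.M 1 * s ^ 2 + 2 * c.M 2 * s + c.M 3 with hm₀
  set m₁ := c.M 1 * s ^ 3 + 2 * c.M 2 * s ^ 2 + 3 * c.M 3 * s + 4 * c.M 4 with hm₁
  obtain ⟨y, hy⟩ := IsAlgClosed.exists_pow_nat_eq ((c.b 0 * m₀ - c.a 0 * m₁) / c.det)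
    (n := 3) (by norm_num)
  obtain ⟨z, hz⟩ := IsAlgClosed.exists_pow_nat_eq ((c.a 3 * m₁ - c.b 3 * m₀) / c.det)
    (n := 3) (by norm_num)
  rw [eq_div_iff hc.det_ne_zero] at hy hz
  have hdet : c.det = c.a 0 * c.b 3 - c.a 3 * c.b 0 := rfl
  have h0 : c.a 0 * z ^ 3 + c.a 3 * y ^ 3 + m₀ = 0 := by
    refine (mul_eq_zero.mp (?_ : c.det * _ = 0)).resolve_left hc.det_ne_zero
    linear_combination c.a 0 * hz + c.a 3 * hy + m₀ * hdet
  have h1 : c.b 0 * z ^ 3 + c.b 3 * y ^ 3 + m₁ = 0 := by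
    refine (mul_eq_zero.mp (?_ : c.det * _ = 0)).resolve_left hc.det_ne_zero
    linear_combination c.b 0 * hz + c.b 3 * hy + m₁ * hdet
  refine ⟨![s, 1, y, z], rfl, rfl, ?_, fun i => ?_⟩
  · simp [quartic, hc.a1, hc.a2, hc.b1, hc.b2, hQ, hL]
    linear_combination s * h0 + h1 - (c.M 0 * s ^ 4 + c.M 1 * s ^ 3 + c.M 2 * s ^ 2 + c.M 3 * s
      + c.M 4) * three
  · fin_cases i <;> simp [quartic, hc.a1, hc.a2, hc.b1, hc.b2, hQ, hL, pderiv_X]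
    · linear_combination h0
    · linear_combination h1
    · linear_combination (s * c.a 3 + c.b 3) * y ^ 2 * three
    · linear_combination (s * c.a 0 + c.b 0) * z ^ 2 * three

/-- The parameters `t` of the special residual cubics. -/
def specialParameters (c : LineCoeffs K) : Set K :=
  {t | t * c.a 3 + c.b 3 = 0 ∨ ∃ s, t * c.pureA s + c.pureB s = 0 ∧ c.cuspPoly.IsRoot s}

theorem IsPure.pureA_ne_zero {c : LineCoeffs K} (hc : c.IsPure) {t s : K}
    (h : t * c.pureA s + c.pureB s = 0) : c.pureA s ≠ 0 := by
  intro hA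
  have hB : c.pureB s = 0 := by simpa [hA] using h
  exact (hc.pureA_or_pureB s).elim (· hA) (· hB)

theorem IsPure.eq_div {c : LineCoeffs K} (hc : c.IsPure) {t s : K}
    (h : t * c.pureA s + c.pureB s = 0) : -c.pureB s / c.pureA s = t := by
  rw [div_eq_iff (hc.pureA_ne_zero h)]
  linear_combination -h

theorem finite_specialParameters {c : LineCoeffs K} (hc : c.IsPure) (hg : c.cuspPoly ≠ 0) :
    c.specialParameters.Finite := by
  refine ((Set.finite_singleton (-c.b 3 / c.a 3)).union
    ((Polynomial.finite_setOfPred_isRoot hg).image fun s => -c.pureB s / c.pureA s)).subset ?_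
  rintro t (h | ⟨s, h, hs⟩)
  · left
    have ha : c.a 3 ≠ 0 := by
      intro ha
      have hb : c.b 3 = 0 := by simpa [ha] using h
      exact hc.a_or_b.elim (· ha) (· hb)
    rw [Set.mem_singleton_iff, eq_div_iff ha]
    linear_combination h
  · exact Or.inr ⟨s, hs, hc.eq_div h⟩

/-- A cube root s turns tα + β into a multiple of (x₁ - s x₂)³. Since β(s) = -tα(s), the value of
`cuspPoly` at s is α(s)³(b₀ + b₁s), so a nonspecial t has b₀ + b₁s ≠ 0. -/
theorem exists_residualCubic_eq [IsAlgClosed K] [CharP K 3] {c : LineCoeffs K} (hc : c.IsPure)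
    (hQ : c.Q = 0) {t : K} (ht : t ∉ c.specialParameters) :
    ∃ r s b₀ b₁ m : K, r ≠ 0 ∧ b₀ + b₁ * s ≠ 0 ∧ t * c.pureA s + c.pureB s = 0 ∧
      residualCubic c.quartic t = cuspidalCubic r s b₀ b₁ m := by
  have three : (3 : K) = 0 := CharP.cast_eq_zero K 3
  have hr : t * c.a 3 + c.b 3 ≠ 0 := fun h => ht (Or.inl h)
  obtain ⟨s, hs⟩ := IsAlgClosed.exists_pow_nat_eq (-(t * c.a 0 + c.b 0) / (t * c.a 3 + c.b 3))
    (n := 3) (by norm_num)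
  rw [eq_div_iff hr] at hs
  have hts : t * c.pureA s + c.pureB s = 0 := by
    rw [pureA, pureB]
    linear_combination hs
  refine ⟨t * c.a 3 + c.b 3, s, t ^ 3 * c.L 0 0 + t ^ 2 * c.L 1 0 + t * c.L 2 0 + c.L 3 0,
    t ^ 3 * c.L 0 1 + t ^ 2 * c.L 1 1 + t * c.L 2 1 + c.L 3 1,
    t ^ 4 * c.M 0 + t ^ 3 * c.M 1 + t ^ 2 * c.M 2 + t * c.M 3 + c.M 4, hr, ?_, hts, ?_⟩
  · intro h
    refine ht (Or.inr ⟨s, hts, ?_⟩)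
    have hB : c.pureB s = -t * c.pureA s := by linear_combination hts
    rw [Polynomial.IsRoot, eval_cuspPoly, hB]
    linear_combination c.pureA s ^ 3 * h
  · have hC : C (t * c.a 0 + c.b 0) = -(C (t * c.a 3 + c.b 3) * C s ^ 3 : MvPolynomial (Fin 3) K) := by
      rw [← C_pow, ← C_mul, ← C_neg]
      congr 1
      linear_combination hs
    have hthree : (3 : MvPolynomial (Fin 3) K) = 0 := CharP.cast_eq_zero _ 3
    rw [residualCubic_quartic, cuspidalCubic, hC, hc.a1, hc.a2, hc.b1, hc.b2, hQ]
    generalize (C (t * c.a 3 + c.b 3) : MvPolynomial (Fin 3) K) = r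
    simp only [mul_zero, add_zero, C_0, zero_mul, Pi.zero_apply]
    linear_combination (r * (X 1 ^ 2 * C s * X 2 - X 1 * C s ^ 2 * X 2 ^ 2)) * hthree

end General

end LineCoeffs

/-! ### Cuspidality of an inseparable line of valency greater than 12 -/

section Criterion

open MvPolynomial

variable {K : Type*} [Field K] [IsAlgClosed K] [CharP K 3]

theorem isCuspidal_of_pure {A : GL (Fin 4) K} {ℓ : Submodule K (Fin 4 → K)}
    (hA : IsAdapted A ℓ) {F : MvPolynomial (Fin 4) K} {c : LineCoeffs K}
    (hG : coords A F = c.quartic) (hc : c.IsPure) (hQ : c.Q = 0) (hg : c.cuspPoly ≠ 0) :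
    IsCuspidal F ℓ := by
  have hfin := LineCoeffs.finite_specialParameters hc hg
  refine ⟨⟨A, hA, hfin.subset fun t ht => ?_⟩, A, hA, c.specialParameters, hfin, fun S hS hsub => ?_⟩
  · by_contra hns
    obtain ⟨r, s, b₀, b₁, m, hr, hk, -, h⟩ := LineCoeffs.exists_residualCubic_eq hc hQ hns
    refine ht ?_
    rw [hG, h]
    exact ⟨irreducible_cuspidalCubic hr hk, _, isCusp_cuspidalCubic hk⟩
  · refine zariskiClosure_eq_points hA ?_ ?_
    · rintro P ⟨t, ht, p, hp, hP⟩
      obtain ⟨r, s, b₀, b₁, m, hr, hk, -, h⟩ :=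
        LineCoeffs.exists_residualCubic_eq hc hQ fun h => ht (hsub h)
      rw [hG, h] at hp
      have hp0 := eq_zero_of_isCusp_cuspidalCubic hk hp
      rw [points, Set.mem_ofPred_eq, hP, Submodule.span_singleton_le_iff_mem, hA.mulVec_mem_iff]
      simp [hp0]
    · intro hU
      -- The parameter t = -β(s)/α(s) is recovered from the cusp s, so finitely many cusps would
      -- leave only finitely many t outside S.
      refine hS.infinite_compl ((hU.image fun s => -c.pureB s / c.pureA s).subset fun t ht => ?_)
      obtain ⟨r, s, b₀, b₁, m, hr, hk, hts, h⟩ :=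
        LineCoeffs.exists_residualCubic_eq hc hQ fun h => ht (hsub h)
      have hne : (![0, 0, s, 1] : Fin 4 → K) ≠ 0 := fun h => by simpa using congrFun h 3
      refine ⟨s, ⟨.mk K _ (mulVec_ne_zero A hne), ⟨t, ht, ![0, s, 1], ?_, ?_⟩,
        Projectivization.submodule_mk _ _⟩, hc.eq_div hts⟩
      · rw [hG, h]
        exact isCusp_cuspidalCubic hk
      · rw [Projectivization.submodule_mk]
        simp

theorem isCuspidal_of_isInseparable {F : MvPolynomial (Fin 4) K} (hF : IsK3Quartic F)
    {ℓ : Submodule K (Fin 4 → K)} (hℓ : IsLineOn F ℓ) (hins : IsInseparable F ℓ)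
    (hv : 12 < valency F ℓ) : IsCuspidal F ℓ := by
  obtain ⟨A, hA, hconst, hsep⟩ := hins
  obtain ⟨c, hG⟩ := hA.exists_lineCoeffs hF.isHomogeneous hℓ
  rw [hG] at hconst hsep
  have hc := LineCoeffs.isPure_of_inseparable hconst hsep
  have hQ : c.Q = 0 := by
    refine LineCoeffs.Q_eq_zero hc.det_ne_zero ?_
    by_contra hf
    exact absurd (valency_le_twelve hA hℓ hG hc hf) (not_le.mpr hv)
  refine isCuspidal_of_pure hA hG hc hQ fun hg => ?_
  have hL := LineCoeffs.L_eq_zero hc.det_ne_zero hg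
  choose v hv0 hv1 hvs using LineCoeffs.exists_isSingularVector hc hQ hL
  refine hF.false_of_singular_family A v (fun s h => ?_) (fun s s' a h => ?_) (hG ▸ hvs)
  · simpa [hv1] using congrFun h 1
  · have h0 := congrFun h 0
    have h1 := congrFun h 1
    simp [hv0, hv1] at h0 h1
    simpa [h1] using h0

end Criterion

/-! ### Equations of surfaces with a cuspidal line -/

section Family

open MvPolynomial

variable {K : Type*} [Field K]

/-- What a singular point `(0, s, 1)` of the residual cubic in the plane `x₀ = t x₁` means. -/
theorem singular_conditions {c : LineCoeffs K} {t s k : K} (hk : k ≠ 0) {p : Fin 3 → K}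
    (hp : IsCusp (residualCubic c.quartic t) p) (h0 : p 0 = 0) (h1 : p 1 = k * s) (h2 : p 2 = k) :
    t * c.alpha.eval s + c.beta.eval s = 0 ∧
    t * c.alpha.derivative.eval s + c.beta.derivative.eval s = 0 ∧
    t ^ 2 * (c.Q 0 0 + c.Q 0 1 * s + c.Q 0 2 * s ^ 2) + t * (c.Q 1 0 + c.Q 1 1 * s + c.Q 1 2 * s ^ 2)
      + (c.Q 2 0 + c.Q 2 1 * s + c.Q 2 2 * s ^ 2) = 0 := by
  have e := hp.2.1
  have e0 := hp.2.2.1 0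
  have e1 := hp.2.2.1 1
  rw [LineCoeffs.residualCubic_quartic] at e e0 e1
  simp [pderiv_X, h0, h1, h2] at e e0 e1
  have hα : c.alpha.eval s = c.a 0 + c.a 1 * s + c.a 2 * s ^ 2 + c.a 3 * s ^ 3 := by
    simp [LineCoeffs.alpha]
  have hβ : c.beta.eval s = c.b 0 + c.b 1 * s + c.b 2 * s ^ 2 + c.b 3 * s ^ 3 := by
    simp [LineCoeffs.beta]
  have hα' : c.alpha.derivative.eval s = c.a 1 + 2 * c.a 2 * s + 3 * c.a 3 * s ^ 2 := by
    simp [LineCoeffs.alpha]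
    ring
  have hβ' : c.beta.derivative.eval s = c.b 1 + 2 * c.b 2 * s + 3 * c.b 3 * s ^ 2 := by
    simp [LineCoeffs.beta]
    ring
  refine ⟨mul_left_cancel₀ (pow_ne_zero 3 hk) ?_, mul_left_cancel₀ (pow_ne_zero 2 hk) ?_,
    mul_left_cancel₀ (pow_ne_zero 2 hk) ?_⟩
  · rw [hα, hβ]
    linear_combination e
  · rw [hα', hβ']
    linear_combination e1
  · linear_combination e0

theorem exists_singular_conditions {A : GL (Fin 4) K} {F : MvPolynomial (Fin 4) K}
    {c : LineCoeffs K} (hG : coords A F = c.quartic) {S : Set K} {s : K}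
    (hs : s ∈ lineParameters A (cusps A F S)) : ∃ t ∉ S,
    t * c.alpha.eval s + c.beta.eval s = 0 ∧
    t * c.alpha.derivative.eval s + c.beta.derivative.eval s = 0 ∧
    t ^ 2 * (c.Q 0 0 + c.Q 0 1 * s + c.Q 0 2 * s ^ 2) + t * (c.Q 1 0 + c.Q 1 1 * s + c.Q 1 2 * s ^ 2)
      + (c.Q 2 0 + c.Q 2 1 * s + c.Q 2 2 * s ^ 2) = 0 := by
  obtain ⟨P, ⟨t, ht, p, hp, hP⟩, hPs⟩ := hs
  have hmem : (A : Matrix (Fin 4) (Fin 4) K).mulVec ![t * p 0, p 0, p 1, p 2] ∈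
      K ∙ ((A : Matrix (Fin 4) (Fin 4) K).mulVec ![0, 0, s, 1]) := by
    rw [← hPs, hP]
    exact Submodule.mem_span_singleton_self _
  obtain ⟨k, hk⟩ := Submodule.mem_span_singleton.mp hmem
  rw [← Matrix.mulVec_smul] at hk
  have hv := mulVec_injective A hk
  have h0 := congrFun hv 1
  have h1 := congrFun hv 2
  have h2 := congrFun hv 3
  simp at h0 h1 h2
  rw [hG] at hp
  refine ⟨t, ht, singular_conditions (k := k) ?_ hp h0.symm h1.symm h2.symm⟩
  rintro rfl
  refine hp.1 ?_
  funext i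
  fin_cases i <;> simp [← h0, ← h1, ← h2]

theorem isSingularVector_of_zero {c : LineCoeffs K} (ha : c.a = 0) (hb : c.b = 0) (s : K) :
    IsSingularVector c.quartic ![0, 0, s, 1] := by
  refine ⟨by simp [LineCoeffs.quartic], fun i => ?_⟩
  fin_cases i <;> simp [LineCoeffs.quartic, pderiv_X, ha, hb]

/-- At a cusp s of a cubic in the plane t, both tα + β and its derivative vanish at s; eliminating t
kills the Wronskian at infinitely many s. For a proportional pencil the common factor w would vanish
at every such s with tl + m ≠ 0, hence identically, making the surface singular along ℓ. -/
theorem isPure_of_isCuspidalCurve [Infinite K] [CharP K 3] {F : MvPolynomial (Fin 4) K}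
    (hF : IsK3Quartic F)
    {ℓ : Submodule K (Fin 4 → K)} {A : GL (Fin 4) K} (hA : IsAdapted A ℓ) {c : LineCoeffs K}
    (hG : coords A F = c.quartic) (hcusp : IsCuspidalCurve A F (points ℓ)) : c.IsPure := by
  obtain ⟨S₀, hS₀, hS⟩ := hcusp
  have hW : c.alpha * c.beta.derivative - c.alpha.derivative * c.beta = 0 := by
    refine Polynomial.eq_zero_of_infinite_isRoot _
      ((infinite_lineParameters hA (hS S₀ hS₀ subset_rfl)).mono fun s hs => ?_)
    obtain ⟨t, -, h1, h2, -⟩ := exists_singular_conditions hG hs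
    rw [Set.mem_ofPred_eq, Polynomial.IsRoot, Polynomial.eval_sub, Polynomial.eval_mul,
      Polynomial.eval_mul]
    linear_combination c.alpha.eval s * h2 - c.alpha.derivative.eval s * h1
  refine (c.isPure_or_proportional hW).resolve_right ?_
  rintro ⟨w, l, m, ha, hb⟩
  by_cases hzero : c.a = 0 ∧ c.b = 0
  · refine hF.false_of_singular_family A (fun s => ![0, 0, s, 1])
      (fun s h => by simpa using congrFun h 3) (fun s s' a h => ?_)
      (hG ▸ isSingularVector_of_zero hzero.1 hzero.2)
    have h2 := congrFun h 2
    have h3 := congrFun h 3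
    simp at h2 h3
    simpa [h3] using h2
  · let c' : LineCoeffs K := { c with a := w }
    have hα : c.alpha = Polynomial.C l * c'.alpha := by
      simp only [LineCoeffs.alpha, ha, c', Pi.smul_apply, smul_eq_mul, Polynomial.C_mul]
      ring
    have hβ : c.beta = Polynomial.C m * c'.alpha := by
      simp only [LineCoeffs.alpha, LineCoeffs.beta, hb, c', Pi.smul_apply, smul_eq_mul,
        Polynomial.C_mul]
      ring
    have hw : c'.alpha = 0 := by
      -- The cuspidal curve is unchanged when one more parameter is left out; -m/l is where tα + β
      -- vanishes identically. For l = 0 the division yields 0, and the extra exclusion is harmless.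
      refine Polynomial.eq_zero_of_infinite_isRoot _ ((infinite_lineParameters hA
        (hS (S₀ ∪ {-m / l}) (hS₀.union (Set.finite_singleton _))
          Set.subset_union_left)).mono fun s hs => ?_)
      obtain ⟨t, ht, h1, -, -⟩ := exists_singular_conditions hG hs
      rw [hα, hβ] at h1
      simp only [Polynomial.eval_mul, Polynomial.eval_C] at h1
      refine (mul_eq_zero.mp (?_ : (t * l + m) * c'.alpha.eval s = 0)).resolve_left fun h => ?_
      · linear_combination h1
      · by_cases hl : l = 0
        · have hm : m = 0 := by simpa [hl] using h
          exact hzero ⟨by simp [ha, hl], by simp [hb, hm]⟩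
        · refine ht (Or.inr ?_)
          rw [Set.mem_singleton_iff, eq_div_iff hl]
          linear_combination h
    have hw0 : w = 0 := LineCoeffs.alpha_eq_zero hw
    exact hzero ⟨by simp [ha, hw0], by simp [hb, hw0]⟩

/-- The derivative transverse to ℓ at the cusp, multiplied by α(s)² with tα(s) = -β(s), is
`tangentPoly` at s, which therefore has infinitely many zeros. -/
theorem Q_eq_zero_of_isCuspidalCurve [Infinite K] {F : MvPolynomial (Fin 4) K}
    {ℓ : Submodule K (Fin 4 → K)} {A : GL (Fin 4) K} (hA : IsAdapted A ℓ) {c : LineCoeffs K}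
    (hG : coords A F = c.quartic) (hcusp : IsCuspidalCurve A F (points ℓ)) (hc : c.IsPure) :
    c.Q = 0 := by
  obtain ⟨S₀, hS₀, hS⟩ := hcusp
  refine LineCoeffs.Q_eq_zero hc.det_ne_zero (Polynomial.eq_zero_of_infinite_isRoot _
      ((infinite_lineParameters hA (hS S₀ hS₀ subset_rfl)).mono fun s hs => ?_))
  obtain ⟨t, -, h1, -, h3⟩ := exists_singular_conditions hG hs
  have hα : c.alpha.eval s = c.pureA s := by
    simp [LineCoeffs.alpha, LineCoeffs.pureA, hc.a1, hc.a2]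
  have hβ : c.beta.eval s = c.pureB s := by
    simp [LineCoeffs.beta, LineCoeffs.pureB, hc.b1, hc.b2]
  rw [hα, hβ] at h1
  have hB : c.pureB s = -t * c.pureA s := by linear_combination h1
  rw [Set.mem_ofPred_eq, Polynomial.IsRoot, LineCoeffs.eval_tangentPoly, hB]
  linear_combination c.pureA s ^ 2 * h3

/-- The linear change of `x₀, x₁` with matrix `(e f; g h)`. -/
def blockMatrix (e f g h : K) : Matrix (Fin 4) (Fin 4) K :=
  !![e, f, 0, 0; g, h, 0, 0; 0, 0, 1, 0; 0, 0, 0, 1]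

theorem det_blockMatrix (e f g h : K) : (blockMatrix e f g h).det = e * h - f * g := by
  simp [blockMatrix, Matrix.det_succ_row_zero, Fin.sum_univ_succ, Fin.succAbove]
  ring

theorem LineCoeffs.exists_familyC {c : LineCoeffs K} (hc : c.IsPure) (hQ : c.Q = 0) :
    ∃ (B : GL (Fin 4) K) (q₃ q₃' q₄ : MvPolynomial (Fin 2) K),
      q₃.IsHomogeneous 3 ∧ q₃'.IsHomogeneous 3 ∧ q₄.IsHomogeneous 4 ∧
      coords B c.quartic = familyC q₃ q₃' q₄ := by
  have hdet := hc.det_ne_zero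
  -- These entries solve the linear equations `r1` to `r4` below, which say that the coefficient of
  -- the new x₀ is x₃³ and that of the new x₁ is -x₂³.
  have hD : (blockMatrix (c.b 3 / c.det) (c.b 0 / c.det) (-c.a 3 / c.det) (-c.a 0 / c.det)).det
      ≠ 0 := by
    rw [det_blockMatrix]
    have : c.b 3 / c.det * (-c.a 0 / c.det) - c.b 0 / c.det * (-c.a 3 / c.det) = -1 / c.det := by
      field_simp
      rw [LineCoeffs.det]
      ring
    rw [this]
    exact div_ne_zero (neg_ne_zero.mpr one_ne_zero) hdet
  set e := c.b 3 / c.det with he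
  set f := c.b 0 / c.det with hf
  set g := -c.a 3 / c.det with hg
  set h := -c.a 0 / c.det with hh
  have r1 : c.a 0 * e + c.b 0 * g = 1 := by
    rw [he, hg]
    field_simp
    rw [LineCoeffs.det]
    ring
  have r2 : c.a 0 * f + c.b 0 * h = 0 := by
    rw [hf, hh]
    field_simp
    ring
  have r3 : c.a 3 * e + c.b 3 * g = 0 := by
    rw [he, hg]
    field_simp
    ring
  have r4 : c.a 3 * f + c.b 3 * h = -1 := by
    rw [hf, hh]
    field_simp
    rw [LineCoeffs.det]
    ring
  clear_value e f g h
  -- The old x₀, x₁ in terms of the new ones; L and M remain forms of degree 3 and 4 in them and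
  -- give q₃, q₃', q₄.
  let y : Fin 2 → MvPolynomial (Fin 2) K := ![C e * X 0 + C f * X 1, C g * X 0 + C h * X 1]
  have hy (i : Fin 2) : (y i).IsHomogeneous 1 := by
    fin_cases i
    · exact ((isHomogeneous_X K _).C_mul e).add ((isHomogeneous_X K _).C_mul f)
    · exact ((isHomogeneous_X K _).C_mul g).add ((isHomogeneous_X K _).C_mul h)
  have hmon (k : K) (i j : ℕ) : (C k * (y 0 ^ i * y 1 ^ j)).IsHomogeneous (i + j) := by
    have := ((hy 0).pow i).mul ((hy 1).pow j)
    rw [one_mul, one_mul] at this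
    exact this.C_mul k
  let q (j : Fin 2) : MvPolynomial (Fin 2) K :=
    C (c.L 0 j) * (y 0 ^ 3 * y 1 ^ 0) + C (c.L 1 j) * (y 0 ^ 2 * y 1 ^ 1)
      + C (c.L 2 j) * (y 0 ^ 1 * y 1 ^ 2) + C (c.L 3 j) * (y 0 ^ 0 * y 1 ^ 3)
  have hq (j : Fin 2) : (q j).IsHomogeneous 3 :=
    (((hmon _ 3 0).add (hmon _ 2 1)).add (hmon _ 1 2)).add (hmon _ 0 3)
  refine ⟨Matrix.GeneralLinearGroup.mkOfDetNeZero _ hD, q 1, q 0,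
    C (c.M 0) * (y 0 ^ 4 * y 1 ^ 0) + C (c.M 1) * (y 0 ^ 3 * y 1 ^ 1)
      + C (c.M 2) * (y 0 ^ 2 * y 1 ^ 2) + C (c.M 3) * (y 0 ^ 1 * y 1 ^ 3)
      + C (c.M 4) * (y 0 ^ 0 * y 1 ^ 4), hq 1, hq 0,
    ((((hmon _ 4 0).add (hmon _ 3 1)).add (hmon _ 2 2)).add (hmon _ 1 3)).add (hmon _ 0 4), ?_⟩
  have r1' := congrArg (C : K → MvPolynomial (Fin 4) K) r1
  have r2' := congrArg (C : K → MvPolynomial (Fin 4) K) r2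
  have r3' := congrArg (C : K → MvPolynomial (Fin 4) K) r3
  have r4' := congrArg (C : K → MvPolynomial (Fin 4) K) r4
  simp only [C_add, C_mul, C_1, C_0, C_neg] at r1' r2' r3' r4'
  have hB : (fun i => ∑ j, C (((Matrix.GeneralLinearGroup.mkOfDetNeZero _ hD : GL (Fin 4) K) :
      Matrix (Fin 4) (Fin 4) K) i j) * X j) =
      (![C e * X 0 + C f * X 1, C g * X 0 + C h * X 1, X 2, X 3] :
        Fin 4 → MvPolynomial (Fin 4) K) := by
    funext i
    fin_cases i <;>
      simp [Matrix.GeneralLinearGroup.mkOfDetNeZero, blockMatrix, Fin.sum_univ_four]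
  rw [coords, hB]
  simp [LineCoeffs.quartic, familyC, hc.a1, hc.a2, hc.b1, hc.b2, hQ, q, y]
  linear_combination X 0 * X 3 ^ 3 * r1' + X 1 * X 3 ^ 3 * r2' + X 0 * X 2 ^ 3 * r3'
    + X 1 * X 2 ^ 3 * r4'

theorem exists_familyC_of_isCuspidal [Infinite K] [CharP K 3] {F : MvPolynomial (Fin 4) K}
    (hF : IsK3Quartic F) {ℓ : Submodule K (Fin 4 → K)} (hℓ : IsLineOn F ℓ)
    (hcusp : IsCuspidal F ℓ) :
    ∃ q₃ q₃' q₄ : MvPolynomial (Fin 2) K,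
      q₃.IsHomogeneous 3 ∧ q₃'.IsHomogeneous 3 ∧ q₄.IsHomogeneous 4 ∧
      ProjectivelyEquivalent F (familyC q₃ q₃' q₄) := by
  obtain ⟨-, A, hA, hcurve⟩ := hcusp
  obtain ⟨c, hG⟩ := hA.exists_lineCoeffs hF.isHomogeneous hℓ
  have hc := isPure_of_isCuspidalCurve hF hA hG hcurve
  have hQ := Q_eq_zero_of_isCuspidalCurve hA hG hcurve hc
  obtain ⟨B, q₃, q₃', q₄, h₃, h₃', h₄, hB⟩ := LineCoeffs.exists_familyC hc hQ
  refine ⟨q₃, q₃', q₄, h₃, h₃', h₄, A * B, 1, one_ne_zero, ?_⟩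
  rw [coords_mul, hG, hB, C_1, one_mul]

end Family

end QuarticLines

theorem mainTheorem11 {K : Type*} [Field K] [IsAlgClosed K] [CharP K 3]
    (F : MvPolynomial (Fin 4) K) (hF : QuarticLines.IsK3Quartic F)
    (ℓ : Submodule K (Fin 4 → K)) (hℓ : QuarticLines.IsLineOn F ℓ) :
    (QuarticLines.IsInseparable F ℓ → 12 < QuarticLines.valency F ℓ →
      QuarticLines.IsCuspidal F ℓ) ∧
    (QuarticLines.IsCuspidal F ℓ →
      ∃ q₃ q₃' q₄ : MvPolynomial (Fin 2) K,
        q₃.IsHomogeneous 3 ∧ q₃'.IsHomogeneous 3 ∧ q₄.IsHomogeneous 4 ∧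
        QuarticLines.ProjectivelyEquivalent F (QuarticLines.familyC q₃ q₃' q₄)) := by
  exact ⟨QuarticLines.isCuspidal_of_isInseparable hF hℓ,
    QuarticLines.exists_familyC_of_isCuspidal hF hℓ⟩
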